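/- Let $(\Omega,d)$ be a compact metric space with a probability measure $m$ for which open sets are measurable, and suppose that there are constants $\delta,a,b,r_0>0$ such that $$a\,r^\delta\le m(B(x,r))\le b\,r^\delta\qquad(x\in\Omega,\ 0<r\le r_0)\,,\tag{M2}$$ where $B(x,r)=\{y\in\Omega:d(x,y)<r\}$. Let $J$ be an infinite countable set, $\mathcal R=(R_\alpha)_{\alpha\in J}$ a family of subsets of $\Omega$ (the resonant sets), and $\beta:J\to(0,\infty)$, $\alpha\mapsto\beta_\alpha$, a function such that $\{\alpha\in J:\beta_\alpha\le T\}$ is finite for every $T$. For $A\subseteq\Omega$ and $t>0$ put $\Delta(A,t)=\{x\in\Omega:\operatorname{dist}(x,A)<t\}$ (with $\Delta(\emptyset,t)=\emptyset$). For a decreasing function $\psi:(0,\infty)\to(0,\infty)$ let $$\Lambda(\psi)=\{x\in\Omega: x\in\Delta(R_\alpha,\psi(\beta_\alpha))\text{ for infinitely many }\alpha\in J\}.$$ Let $l=(l_n)$ and $u=(u_n)$ be increasing sequences of positive reals with $l_n<u_n$ and $l_n\to\infty$, and let $\rho:(0,\infty)\to(0,\infty)$ satisfy $\rho(r)\to0$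 as $r\to\infty$. Suppose that $(\mathcal R,\beta)$ is locally $m$-ubiquitous relative to $(\rho,l,u)$ with common dimension $\gamma$; that is: (a) there are constants $\kappa,r_1>0$ such that for every ball $B=B(x,r)$ with $x\in\Omega$ and $0<r\le r_1$ there is an $n_0(B)$ with $$m\Big(B\cap\bigcup_{\alpha\in J:\ l_n<\beta_\alpha\le u_n}\Delta(R_\alpha,\rho(u_n))\Big)\ \ge\ \kappa\,m(B)\qquad(n\ge n_0(B));$$ (b) $0\le\gamma\le\dim\Omega$ (Hausdorff dimension), and there are constants $c_1,c_2>0$ such that for all sufficiently large $n$, all $\alpha\in J$ with $\beta_\alpha\le u_n$, all $c\in R_\alpha$ and all $0<\lambda\le\rho(u_n)$, $$m\big(B(c,\tfrac12\rho(u_n))\cap\Delta(R_\alpha,\lambda)\big)\ \ge\ c_1\,m(B(c,\lambda))\Big(\frac{\rho(u_n)}{\lambda}\Big)^{\gamma},$$ $$m\big(B\cap B(c,3\rho(u_n))\cap\Delta(R_\alpha,3\lambda)\big)\ \le\ c_2\,m(B(c,\lambda))\Big(\frac{r(B)}{\lambda}\Big)^{\gamma}$$ for every ball $B$ of radius $0<r(B)\le3\rho(u_n)$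 centred at a point of some resonant set. Let $\psi:(0,\infty)\to(0,\infty)$ be decreasing, and let $f:(0,\infty)\to(0,\infty)$ be a dimension function, i.e. increasing and continuous with $f(r)\to0$ as $r\to0$. Suppose that $r^{-\delta}f(r)\to\infty$ as $r\to0$, that $r^{-\delta}f(r)$ is decreasing, and that $r^{-\gamma}f(r)$ is increasing (monotonicity is meant in the weak sense throughout). Define $$g(r)=f(\psi(r))\,\psi(r)^{-\gamma}\rho(r)^{\gamma-\delta},\qquad G=\limsup_{n\to\infty}g(u_n)\in[0,\infty].$$ The Hausdorff $f$-measure of $F\subseteq\Omega$ is $\mathcal H^f(F)=\sup_{t>0}\inf\big\{\sum_i f(r_i)\big\}$, the infimum being over all countable covers of $F$ by balls $B(x_i,r_i)$ with $x_i\in\Omega$ and $0<r_i\le t$. (i) Suppose that $G=0$ and that $\rho$ is $u$-regular, i.e. there is a constant $0<c<1$ with $\rho(u_{n+1})\le c\,\rho(u_n)$ for all sufficiently large $n$. If $\sum_{n}g(u_n)=\infty$, then $\mathcal H^f(\Lambda(\psi))=\infty$. (ii) If $0<G\le\infty$, then $\mathcal H^f(\Lambda(\psi))=\infty$. -/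

import Mathlib

open Set Filter Topology MeasureTheory

namespace Ubiquity

/-- A dimension function: a positive, increasing, continuous function on `(0, ∞)` tending to `0`
at `0`. Only the values on `(0, ∞)` are relevant. -/
structure IsDimensionFunction (f : ℝ → ℝ) : Prop where
  pos : ∀ r, 0 < r → 0 < f r
  mono : MonotoneOn f (Ioi 0)
  cont : ContinuousOn f (Ioi 0)
  lim : Tendsto f (𝓝[>] 0) (𝓝 0)

/-- The infimum of `∑ f (rᵢ)` over all countable covers of `F` by balls of radii `0 < rᵢ ≤ t`.
A cover is recorded as a countable set of pairs (centre, radius). -/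
noncomputable def hausdorffPre {Ω : Type*} [MetricSpace Ω] (f : ℝ → ℝ) (t : ℝ) (F : Set Ω) :
    ENNReal :=
  ⨅ (C : Set (Ω × ℝ)) (_ : C.Countable) (_ : ∀ p ∈ C, 0 < p.2 ∧ p.2 ≤ t)
    (_ : F ⊆ ⋃ p ∈ C, Metric.ball p.1 p.2), ∑' p : C, ENNReal.ofReal (f (p : Ω × ℝ).2)

/-- The Hausdorff `f`-measure of `F`. -/
noncomputable def hausdorffMeasureFun {Ω : Type*} [MetricSpace Ω] (f : ℝ → ℝ) (F : Set Ω) :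
    ENNReal :=
  ⨆ (t : ℝ) (_ : 0 < t), hausdorffPre f t F

/-- The measure of every ball of small radius `r` is comparable to `r ^ δ`, where `δ > 0`. -/
def PowerLaw {Ω : Type*} [MetricSpace Ω] [MeasurableSpace Ω] (m : Measure Ω) (δ : ℝ) : Prop :=
  0 < δ ∧ ∃ a b r₀ : ℝ, 0 < a ∧ 0 < b ∧ 0 < r₀ ∧ ∀ (x : Ω) (r : ℝ), 0 < r → r ≤ r₀ →
    ENNReal.ofReal (a * r ^ δ) ≤ m (Metric.ball x r) ∧
      m (Metric.ball x r) ≤ ENNReal.ofReal (b * r ^ δ)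

/-- The weights are positive, and only finitely many of them lie below any given bound. -/
structure IsWeight {J : Type*} (β : J → ℝ) : Prop where
  pos : ∀ α, 0 < β α
  finite_le : ∀ T : ℝ, {α | β α ≤ T}.Finite

/-- Lower and upper sequences: positive and increasing, with `l n < u n` and `l n → ∞`. -/
structure IsLowerUpper (l u : ℕ → ℝ) : Prop where
  l_pos : ∀ n, 0 < l n
  l_mono : Monotone l
  u_mono : Monotone u
  lt : ∀ n, l n < u n
  l_lim : Tendsto l atTop atTop

/-- An approximating function: positive and decreasing on `(0, ∞)`. -/
structure IsApproximating (ψ : ℝ → ℝ) : Prop where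
  pos : ∀ r, 0 < r → 0 < ψ r
  anti : AntitoneOn ψ (Ioi 0)

/-- A (candidate) ubiquitous function: positive on `(0, ∞)` and tending to `0` at infinity. -/
structure IsUbiquityFunction (ρ : ℝ → ℝ) : Prop where
  pos : ∀ r, 0 < r → 0 < ρ r
  lim : Tendsto ρ atTop (𝓝 0)

/-- The points lying in infinitely many of the neighbourhoods of radius `ψ (β α)` of the resonant
sets `R α`. (The neighbourhood of an empty set is empty.) -/
def limsupSet {Ω J : Type*} [MetricSpace Ω] (R : J → Set Ω) (β : J → ℝ) (ψ : ℝ → ℝ) : Set Ω :=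
  {x | {α | x ∈ Metric.thickening (ψ (β α)) (R α)}.Infinite}

/-- The union of the neighbourhoods of radius `ρ (u n)` of the resonant sets `R α` with
`l n < β α ≤ u n`. -/
def unionNhd {Ω J : Type*} [MetricSpace Ω] (R : J → Set Ω) (β : J → ℝ) (ρ : ℝ → ℝ)
    (l u : ℕ → ℝ) (n : ℕ) : Set Ω :=
  ⋃ (α : J) (_ : l n < β α ∧ β α ≤ u n), Metric.thickening (ρ (u n)) (R α)

/-- The intersection conditions with common dimension `γ`. In the second inequality `ball y s` is
an arbitrary ball centred at a point of some resonant set. -/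
def IntersectionConditions {Ω J : Type*} [MetricSpace Ω] [MeasurableSpace Ω] (m : Measure Ω)
    (R : J → Set Ω) (β : J → ℝ) (ρ : ℝ → ℝ) (u : ℕ → ℝ) (γ : ℝ) : Prop :=
  0 ≤ γ ∧ ENNReal.ofReal γ ≤ dimH (univ : Set Ω) ∧
  ∃ c₁ c₂ : ℝ, 0 < c₁ ∧ 0 < c₂ ∧ ∀ᶠ n in atTop, ∀ α : J, β α ≤ u n → ∀ c ∈ R α, ∀ t : ℝ,
    0 < t → t ≤ ρ (u n) →
    ENNReal.ofReal c₁ * m (Metric.ball c t) * ENNReal.ofReal ((ρ (u n) / t) ^ γ) ≤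
        m (Metric.ball c (ρ (u n) / 2) ∩ Metric.thickening t (R α)) ∧
      ∀ y ∈ ⋃ α' : J, R α', ∀ s : ℝ, 0 < s → s ≤ 3 * ρ (u n) →
        m (Metric.ball y s ∩ Metric.ball c (3 * ρ (u n)) ∩ Metric.thickening (3 * t) (R α)) ≤
          ENNReal.ofReal c₂ * m (Metric.ball c t) * ENNReal.ofReal ((s / t) ^ γ)

/-- `(R, β)` is a local `m`-ubiquitous system relative to `(ρ, l, u)`, where `γ` is the common
dimension in the intersection conditions. -/
def LocallyUbiquitous {Ω J : Type*} [MetricSpace Ω] [MeasurableSpace Ω] (m : Measure Ω)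
    (R : J → Set Ω) (β : J → ℝ) (ρ : ℝ → ℝ) (l u : ℕ → ℝ) (γ : ℝ) : Prop :=
  (∃ κ r₀ : ℝ, 0 < κ ∧ 0 < r₀ ∧ ∀ (x : Ω) (r : ℝ), 0 < r → r ≤ r₀ → ∀ᶠ n in atTop,
    ENNReal.ofReal κ * m (Metric.ball x r) ≤ m (Metric.ball x r ∩ unionNhd R β ρ l u n)) ∧
  IntersectionConditions m R β ρ u γ

/-- `h` is `u`-regular. -/
def IsRegularAlong (u : ℕ → ℝ) (h : ℝ → ℝ) : Prop :=
  ∃ c : ℝ, 0 < c ∧ c < 1 ∧ ∀ᶠ n in atTop, h (u (n + 1)) ≤ c * h (u n)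

/-- The function `g (r) = f (ψ (r)) ψ (r) ^ (-γ) ρ (r) ^ (γ - δ)`. -/
noncomputable def gFun (f ψ ρ : ℝ → ℝ) (γ δ : ℝ) (r : ℝ) : ℝ :=
  f (ψ r) * ψ r ^ (-γ) * ρ r ^ (γ - δ)

/-- `G = limsup g (u n)`, an element of `[0, ∞]`. -/
noncomputable def limsupG (f ψ ρ : ℝ → ℝ) (γ δ : ℝ) (u : ℕ → ℝ) : ENNReal :=
  limsup (fun n => ENNReal.ofReal (gFun f ψ ρ γ δ (u n))) atTop

end Ubiquity

/-!
Call a set Frostman rich if every small ball `B(x, s)` carries a probability measure `ν` of bounded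
density with respect to `m`, living well inside the set, with `ν (B(y, r)) ≤ ε s ^ (-δ) f(r)` and
`ε` as small as desired. A countable intersection of Frostman rich sets has infinite Hausdorff
`f`-measure: replacing the mass of a measure at scale `s` by such measures `ν` costs little in a
bound `μ (B(y, r)) ≤ f(r) / η`, because `s ^ (-δ) f(s)` is large for small `s`, so one can enter
the sets one after the other and apply the mass distribution principle.

Ubiquity packs each ball `B(x, s)` with about `(s / ρ(u n)) ^ δ` separated points of the resonant
sets of level `n`. Spread mass `g(u n) ρ(u n) ^ δ` uniformly over the neighbourhood of the resonant
set around each of these points, leaving out the few points which come close to earlier levels.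
Each level respects the Frostman bound, and at small scales a ball sees only one of them. So if the
`g(u n)` have a divergent sum along a sequence of rapidly decreasing scales, then normalising makes
the constant in the bound arbitrarily small: the union of the levels is Frostman rich, and so are
the unions of its tails, whose intersection lies in `Λ(ψ)`. Such a sequence exists trivially if
`G > 0`, and among the arithmetic progressions of indices if `ρ` is `u`-regular.
-/

open ProbabilityTheory
open scoped NNReal ENNReal

namespace Ubiquity

theorem rpow_neg_mul_le_rpow_neg_mul_iff {x y : ℝ} (hx : 0 < x) (hy : 0 < y) (p u v : ℝ) :
    x ^ (-p) * u ≤ y ^ (-p) * v ↔ y ^ p * u ≤ x ^ p * v := by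
  rw [Real.rpow_neg hx.le, Real.rpow_neg hy.le, inv_mul_eq_div, inv_mul_eq_div,
    div_le_div_iff₀ (by positivity) (by positivity), mul_comm u, mul_comm v]

theorem exists_forall_mul_rpow_le {f : ℝ → ℝ} {δ : ℝ}
    (hf : Tendsto (fun r : ℝ => r ^ (-δ) * f r) (𝓝[>] 0) atTop) (M : ℝ) :
    ∃ s > 0, ∀ r, 0 < r → r ≤ s → M * r ^ δ ≤ f r := by
  obtain ⟨s, hs, hs'⟩ := mem_nhdsGT_iff_exists_Ioc_subset.1 (hf.eventually_ge_atTop M)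
  refine ⟨s, hs, fun r hr hrs => ?_⟩
  have hM : M ≤ r ^ (-δ) * f r := hs' ⟨hr, hrs⟩
  rwa [Real.rpow_neg hr.le, inv_mul_eq_div, le_div_iff₀ (by positivity)] at hM

theorem apply_two_mul_le {f : ℝ → ℝ} {δ : ℝ}
    (hf : AntitoneOn (fun r : ℝ => r ^ (-δ) * f r) (Ioi 0)) {r : ℝ} (hr : 0 < r) :
    f (2 * r) ≤ 2 ^ δ * f r := by
  have h2r : 0 < 2 * r := by positivity
  have hanti := hf (mem_Ioi.2 hr) (mem_Ioi.2 h2r) (by linarith)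
  rw [rpow_neg_mul_le_rpow_neg_mul_iff h2r hr, Real.mul_rpow zero_le_two hr.le] at hanti
  have hrδ : 0 < r ^ δ := by positivity
  exact le_of_mul_le_mul_left (hanti.trans_eq (by ring)) hrδ

theorem lt_of_monotoneOn_of_tendsto {f : ℝ → ℝ} {γ δ : ℝ} (hf : ∀ r, 0 < r → 0 < f r)
    (hfδ : Tendsto (fun r : ℝ => r ^ (-δ) * f r) (𝓝[>] 0) atTop)
    (hfγ_mono : MonotoneOn (fun r : ℝ => r ^ (-γ) * f r) (Ioi 0)) : γ < δ := by
  by_contra! hle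
  obtain ⟨r, hr, hr0, hr1⟩ := ((hfδ.eventually_gt_atTop (f 1)).and
    (Ioo_mem_nhdsGT (zero_lt_one' ℝ))).exists
  refine hr.not_ge ?_
  calc r ^ (-δ) * f r ≤ r ^ (-γ) * f r := by
        gcongr ?_ * _
        · exact (hf r hr0).le
        · exact Real.rpow_le_rpow_of_exponent_ge hr0 hr1.le (by linarith)
    _ ≤ 1 ^ (-γ) * f 1 := hfγ_mono hr0 (mem_Ioi.2 one_pos) hr1.le
    _ = f 1 := by simp

theorem sum_le_of_card_ne_zero_le_one {ι : Type*} {s : Finset ι} {v : ι → ℝ} {B : ℝ} (hB : 0 ≤ B)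
    (hv : ∀ i ∈ s, v i ≤ B) (hone : ∀ i ∈ s, ∀ j ∈ s, v i ≠ 0 → v j ≠ 0 → i = j) :
    ∑ i ∈ s, v i ≤ B := by
  classical
  have hcard : (s.filter (v · ≠ 0)).card ≤ 1 := Finset.card_le_one.2 fun i hi j hj =>
    hone i (Finset.mem_filter.1 hi).1 j (Finset.mem_filter.1 hj).1
      (Finset.mem_filter.1 hi).2 (Finset.mem_filter.1 hj).2
  calc ∑ i ∈ s, v i = ∑ i ∈ s with v i ≠ 0, v i := (Finset.sum_filter_ne_zero s).symm
    _ ≤ (s.filter (v · ≠ 0)).card • B :=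
      Finset.sum_le_card_nsmul _ _ _ fun i hi => hv i (Finset.mem_filter.1 hi).1
    _ ≤ 1 • B := nsmul_le_nsmul_left hB hcard
    _ = B := one_nsmul B

theorem summable_of_summable_min {g : ℕ → ℝ} {K : ℝ} (hK : 0 < K)
    (h : Summable fun n => min (g n) K) : Summable g := by
  refine h.congr_atTop ?_
  filter_upwards [h.tendsto_atTop_zero.eventually_lt_const hK] with n hn
  exact min_eq_left ((min_lt_iff.1 hn).resolve_right (lt_irrefl K)).le

theorem exists_sum_range_lt_le_sum_range_succ {g : ℕ → ℝ} (hg : ∀ n, 0 ≤ g n)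
    (hsum : ¬ Summable g) {K : ℝ} (hK : 0 < K) :
    ∃ M, ∑ i ∈ Finset.range M, g i < K ∧ K ≤ ∑ i ∈ Finset.range (M + 1), g i := by
  classical
  have hex : ∃ n, K ≤ ∑ i ∈ Finset.range (n + 1), g i :=
    (((not_summable_iff_tendsto_nat_atTop_of_nonneg hg).1 hsum).comp
      (tendsto_add_atTop_nat 1)).eventually_ge_atTop K |>.exists
  refine ⟨Nat.find hex, ?_, Nat.find_spec hex⟩
  rcases h : Nat.find hex with _ | n
  · simpa using hK
  · exact not_le.1 (Nat.find_min hex (by omega))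

theorem exists_lacunary_sum_rpow_le {p ζ : ℝ} (hp : 0 < p) (hζ : 0 < ζ) :
    ∃ θ > 0, θ ≤ 1 / 8 ∧ ∀ ρ : ℕ → ℝ, (∀ n, 0 < ρ n) → (∀ n, ρ (n + 1) ≤ θ * ρ n) →
      ∀ k, ∑ i ∈ Finset.range k, (4 * ρ k / ρ i) ^ p ≤ ζ := by
  -- `q` solves `q * (ζ + 4 ^ p) = ζ`, and `θ ^ p ≤ q`.
  set q : ℝ := ζ / (ζ + 4 ^ p) with hq
  have hq0 : 0 < q := by positivity
  set θ := min (1 / 8) (q ^ p⁻¹)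
  have hθ0 : 0 < θ := by positivity
  have hθp : θ ^ p ≤ q :=
    (Real.rpow_le_rpow hθ0.le (min_le_right _ _) hp.le).trans_eq (Real.rpow_inv_rpow hq0.le hp.ne')
  refine ⟨θ, hθ0, min_le_left _ _, fun ρ hρ hlac k => ?_⟩
  induction k with
  | zero => simpa using hζ.le
  | succ k ih =>
    have hterm (i : ℕ) : (4 * ρ (k + 1) / ρ i) ^ p ≤ θ ^ p * (4 * ρ k / ρ i) ^ p := by
      have hi := hρ i
      have hk := hρ k
      have hk' := hρ (k + 1)
      rw [← Real.mul_rpow hθ0.le (by positivity), ← mul_div_assoc]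
      gcongr ?_ ^ p
      gcongr ?_ / _
      linarith [hlac k]
    have hsum : 0 ≤ ∑ i ∈ Finset.range (k + 1), (4 * ρ k / ρ i) ^ p :=
      Finset.sum_nonneg fun i _ =>
        Real.rpow_nonneg (div_nonneg (mul_nonneg zero_le_four (hρ k).le) (hρ i).le) _
    calc ∑ i ∈ Finset.range (k + 1), (4 * ρ (k + 1) / ρ i) ^ p
        ≤ θ ^ p * ∑ i ∈ Finset.range (k + 1), (4 * ρ k / ρ i) ^ p := by
          rw [Finset.mul_sum]
          exact Finset.sum_le_sum fun i _ => hterm i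
      _ ≤ q * ∑ i ∈ Finset.range (k + 1), (4 * ρ k / ρ i) ^ p := by gcongr
      _ ≤ q * (ζ + 4 ^ p) := by
          rw [Finset.sum_range_succ, mul_div_assoc, div_self (hρ k).ne', mul_one]
          gcongr
      _ = ζ := by rw [hq]; field_simp

/-- The series `∑ g n` diverges along subsequences on which the scales `ρ n` decrease as fast as
one wishes. -/
def DivergesLacunarily (ρ g : ℕ → ℝ) : Prop :=
  ∀ θ > 0, ∃ φ : ℕ → ℕ, StrictMono φ ∧ (∀ n, ρ (φ (n + 1)) ≤ θ * ρ (φ n)) ∧ ¬ Summable (g ∘ φ)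

namespace DivergesLacunarily

variable {ρ g : ℕ → ℝ}

theorem of_mul_le {g' : ℕ → ℝ} {c : ℝ} (h : DivergesLacunarily ρ g) (hc : 0 < c)
    (hg : ∀ n, 0 ≤ g n) (hle : ∀ n, c * g n ≤ g' n) : DivergesLacunarily ρ g' := by
  intro θ hθ
  obtain ⟨φ, hφ, hlac, hsum⟩ := h θ hθ
  refine ⟨φ, hφ, hlac, fun hs => hsum ((summable_mul_left_iff hc.ne').1 ?_)⟩
  exact hs.of_nonneg_of_le (fun n => mul_nonneg hc.le (hg _)) fun n => hle _

theorem comp_add_right (h : DivergesLacunarily ρ g) (N : ℕ) :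
    DivergesLacunarily (fun n => ρ (n + N)) fun n => g (n + N) := by
  intro θ hθ
  obtain ⟨φ, hφ, hlac, hsum⟩ := h θ hθ
  have hsub (n : ℕ) : φ (n + N) - N + N = φ (n + N) :=
    Nat.sub_add_cancel ((Nat.le_add_left N n).trans (hφ.le_apply))
  refine ⟨fun n => φ (n + N) - N, strictMono_nat_of_lt_succ fun n => ?_, fun n => ?_, ?_⟩
  · have := hφ (show n + N < n + 1 + N by omega)
    have := hsub n
    omega
  · simp only [hsub]
    rw [add_right_comm]
    exact hlac (n + N)
  · simpa only [Function.comp_def, hsub] using fun hs => hsum ((summable_nat_add_iff N).1 hs)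

theorem of_regular {c : ℝ} (hρ : ∀ n, 0 < ρ n) (hg : ∀ n, 0 ≤ g n) (hc : 0 < c) (hc1 : c < 1)
    (hreg : ∀ᶠ n in atTop, ρ (n + 1) ≤ c * ρ n) (hsum : ¬ Summable g) :
    DivergesLacunarily ρ g := by
  intro θ hθ
  obtain ⟨N, hN⟩ := eventually_atTop.1 hreg
  obtain ⟨P, hP⟩ := exists_pow_lt_of_lt_one hθ hc1
  have hiter (j n : ℕ) (hn : N ≤ n) : ρ (n + j) ≤ c ^ j * ρ n := by
    induction j with
    | zero => simp
    | succ j ih =>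
      calc ρ (n + j + 1) ≤ c * ρ (n + j) := hN _ (by omega)
        _ ≤ c * (c ^ j * ρ n) := by gcongr
        _ = c ^ (j + 1) * ρ n := by ring
  -- The series diverges along one of the residue classes modulo `P + 1`.
  obtain ⟨i, hi⟩ : ∃ i : Fin (P + 1), ¬ Summable fun k => g (k * (P + 1) + i + N) := by
    by_contra! hall
    refine hsum ((summable_nat_add_iff N).1 ?_)
    rw [← (Nat.divModEquiv (P + 1)).symm.summable_iff, ← (Equiv.prodComm _ _).summable_iff]
    refine (summable_prod_of_nonneg fun _ => hg _).2 ⟨fun i => ?_, Summable.of_finite⟩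
    exact hall i
  refine ⟨fun k => k * (P + 1) + i + N, strictMono_nat_of_lt_succ fun k => ?_, fun k => ?_, hi⟩
  · rw [add_mul]
    omega
  · calc ρ ((k + 1) * (P + 1) + i + N) = ρ (k * (P + 1) + i + N + (P + 1)) := by ring_nf
      _ ≤ c ^ (P + 1) * ρ (k * (P + 1) + i + N) := hiter _ _ (by omega)
      _ ≤ θ * ρ (k * (P + 1) + i + N) :=
        mul_le_mul_of_nonneg_right
          ((pow_le_pow_of_le_one hc.le hc1.le P.le_succ).trans hP.le) (hρ _).le

theorem of_frequently {ε : ℝ} (hρ : ∀ n, 0 < ρ n) (hρ0 : Tendsto ρ atTop (𝓝 0)) (hε : 0 < ε)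
    (hfreq : ∃ᶠ n in atTop, ε ≤ g n) : DivergesLacunarily ρ g := by
  intro θ hθ
  have hstep (n : ℕ) : ∃ n', n < n' ∧ ρ n' ≤ θ * ρ n ∧ ε ≤ g n' := by
    obtain ⟨n', hg, hρ, hn⟩ := (hfreq.and_eventually
      ((hρ0.eventually_le_const (mul_pos hθ (hρ n))).and (eventually_gt_atTop n))).exists
    exact ⟨n', hn, hρ, hg⟩
  choose next hlt hle hge using hstep
  refine ⟨fun k => next^[k + 1] 0, strictMono_nat_of_lt_succ fun k => ?_, fun k => ?_, fun hs => ?_⟩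
  · rw [Function.iterate_succ_apply' next (k + 1)]
    exact hlt _
  · simp only [Function.iterate_succ_apply' next (k + 1)]
    exact hle _
  · obtain ⟨k, hk⟩ := (hs.tendsto_atTop_zero.eventually_lt_const hε).exists
    simp only [Function.comp_apply, Function.iterate_succ_apply' next k] at hk
    exact hk.not_ge (hge _)

end DivergesLacunarily

theorem exists_finset_separated_net {X : Type*} [PseudoMetricSpace X] [CompactSpace X] (P : Set X)
    {D : ℝ} (hD : 0 < D) :
    ∃ S : Finset X, (S : Set X) ⊆ P ∧ (S : Set X).Pairwise (fun x y => D < dist x y) ∧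
      ∀ x ∈ P, ∃ y ∈ S, dist x y ≤ D := by
  lift D to ℝ≥0 using hD.le
  obtain ⟨N, -, hN, hcover⟩ := Metric.exists_finite_isCover_of_totallyBounded
    (div_pos (NNReal.coe_pos.1 hD) two_pos).ne'
    (isCompact_univ.totallyBounded.subset (subset_univ P))
  have hpack : Metric.packingNumber D P ≠ ⊤ := by
    have hle := (Metric.packingNumber_two_mul_le_externalCoveringNumber (D / 2) P).trans
      hcover.externalCoveringNumber_le_encard
    rw [mul_div_cancel₀ D two_ne_zero] at hle
    exact ne_top_of_le_ne_top (encard_ne_top_iff.2 hN) hle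
  have hfin : (Metric.maximalSeparatedSet D P).Finite := by
    rwa [← encard_ne_top_iff, Metric.encard_maximalSeparatedSet hpack]
  refine ⟨hfin.toFinset, ?_, fun x hx y hy hne => ?_, fun x hx => ?_⟩
  · simpa only [hfin.coe_toFinset] using Metric.maximalSeparatedSet_subset
  · rw [hfin.coe_toFinset] at hx hy
    have hsep : (D : ℝ≥0∞) < edist x y := Metric.isSeparated_maximalSeparatedSet hx hy hne
    rw [edist_nndist] at hsep
    exact NNReal.coe_lt_coe.2 (ENNReal.coe_lt_coe.1 hsep)
  · simpa only [mem_iUnion, exists_prop, Metric.mem_closedBall, hfin.mem_toFinset] using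
      (Metric.isCover_maximalSeparatedSet hpack).subset_iUnion_closedBall hx

theorem exists_simpleFunc_dist_lt {X : Type*} [PseudoMetricSpace X] [CompactSpace X]
    [MeasurableSpace X] [OpensMeasurableSpace X] [Nonempty X] {s : ℝ} (hs : 0 < s) :
    ∃ π : SimpleFunc X X, ∀ x, dist (π x) x < s := by
  have hdense := TopologicalSpace.denseRange_denseSeq X
  set e := TopologicalSpace.denseSeq X
  obtain ⟨I, hI⟩ := isCompact_univ.elim_finite_subcover (fun k => Metric.ball (e k) s)
    (fun _ => Metric.isOpen_ball) fun x _ => by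
      obtain ⟨k, hk⟩ := hdense.exists_dist_lt x hs
      exact mem_iUnion.2 ⟨k, hk⟩
  refine ⟨SimpleFunc.nearestPt e (I.sup id), fun x => ?_⟩
  obtain ⟨k, hk, hx⟩ := mem_iUnion₂.1 (hI (mem_univ x))
  have hnearest := SimpleFunc.edist_nearestPt_le e x (Finset.le_sup (f := id) hk)
  rw [edist_dist, edist_dist, ENNReal.ofReal_le_ofReal_iff dist_nonneg] at hnearest
  exact hnearest.trans_lt (Metric.mem_ball'.1 hx)

/-- Two-sided power bounds for the measure of balls. Unlike in `PowerLaw`, the upper bound holds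
at all radii. -/
structure AhlforsBounds {Ω : Type*} [PseudoMetricSpace Ω] [MeasurableSpace Ω] (m : Measure Ω)
    (δ a b r₀ : ℝ) : Prop where
  δ_pos : 0 < δ
  a_pos : 0 < a
  b_pos : 0 < b
  r₀_pos : 0 < r₀
  lower : ∀ (x : Ω) (r : ℝ), 0 < r → r ≤ r₀ → a * r ^ δ ≤ m.real (Metric.ball x r)
  upper : ∀ (x : Ω) (r : ℝ), 0 < r → m.real (Metric.ball x r) ≤ b * r ^ δ

theorem PowerLaw.exists_ahlforsBounds {Ω : Type*} [MetricSpace Ω] [MeasurableSpace Ω]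
    {m : Measure Ω} [IsFiniteMeasure m] {δ : ℝ} (h : PowerLaw m δ) :
    ∃ a b r₀ : ℝ, AhlforsBounds m δ a b r₀ := by
  obtain ⟨hδ, a, b, r₀, ha, hb, hr₀, h⟩ := h
  refine ⟨a, max b (m.real univ / r₀ ^ δ), r₀, hδ, ha, lt_max_of_lt_left hb, hr₀,
    fun x r hr hr' => ?_, fun x r hr => ?_⟩
  · exact (ENNReal.ofReal_le_iff_le_toReal (measure_ne_top _ _)).1 (h x r hr hr').1
  rcases le_total r r₀ with hr' | hr'
  · refine (ENNReal.toReal_le_of_le_ofReal (by positivity) (h x r hr hr').2).trans ?_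
    gcongr
    exact le_max_left _ _
  · calc m.real (Metric.ball x r) ≤ m.real univ := measureReal_mono (subset_univ _)
      _ = m.real univ / r₀ ^ δ * r₀ ^ δ := by field_simp
      _ ≤ max b (m.real univ / r₀ ^ δ) * r ^ δ := by
        gcongr
        exact le_max_right _ _

namespace AhlforsBounds

variable {Ω : Type*} [PseudoMetricSpace Ω] [MeasurableSpace Ω] {m : Measure Ω}
  [IsFiniteMeasure m] {δ a b r₀ : ℝ}

theorem exists_packing [CompactSpace Ω] (hB : AhlforsBounds m δ a b r₀) {Z : Set Ω} {x₀ : Ω}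
    {κ ρ s : ℝ} (hκ : 0 < κ) (hρ : 0 < ρ) (hs₀ : s ≤ r₀) (hρs : ρ ≤ s / 4)
    (hZ : κ * m.real (Metric.ball x₀ (s / 2)) ≤
      m.real (Metric.ball x₀ (s / 2) ∩ ⋃ c ∈ Z, Metric.ball c ρ)) :
    ∃ S : Finset Ω, (∀ c ∈ S, c ∈ Z ∧ dist c x₀ ≤ 3 * s / 4) ∧
      (S : Set Ω).Pairwise (fun x y => 4 * ρ < dist x y) ∧
      κ * a / (b * 10 ^ δ) * s ^ δ ≤ S.card * ρ ^ δ := by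
  have hb := hB.b_pos
  have hs : 0 < s := by linarith
  obtain ⟨S, hSZ, hSsep, hnet⟩ := exists_finset_separated_net
    {c | c ∈ Z ∧ dist c x₀ ≤ 3 * s / 4} (D := 4 * ρ) (by positivity)
  have hsub : Metric.ball x₀ (s / 2) ∩ ⋃ c ∈ Z, Metric.ball c ρ ⊆
      ⋃ c ∈ S, Metric.ball c (5 * ρ) := by
    rintro z ⟨hz, hz'⟩
    simp only [mem_iUnion, exists_prop, Metric.mem_ball] at hz hz' ⊢
    obtain ⟨c, hc, hzc⟩ := hz'
    obtain ⟨y, hy, hcy⟩ := hnet c ⟨hc, by linarith [dist_triangle_left c x₀ z]⟩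
    exact ⟨y, hy, by linarith [dist_triangle z c y]⟩
  refine ⟨S, fun c hc => hSZ hc, hSsep, ?_⟩
  have hcard : κ * (a * (s / 2) ^ δ) ≤ S.card * (b * (5 * ρ) ^ δ) :=
    calc κ * (a * (s / 2) ^ δ) ≤ κ * m.real (Metric.ball x₀ (s / 2)) := by
          gcongr
          exact hB.lower _ _ (by positivity) (by linarith)
      _ ≤ m.real (⋃ c ∈ S, Metric.ball c (5 * ρ)) :=
        hZ.trans (measureReal_mono hsub (measure_ne_top _ _))
      _ ≤ ∑ c ∈ S, m.real (Metric.ball c (5 * ρ)) := measureReal_biUnion_finset_le _ _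
      _ ≤ ∑ c ∈ S, b * (5 * ρ) ^ δ := Finset.sum_le_sum fun c _ => hB.upper c _ (by positivity)
      _ = S.card * (b * (5 * ρ) ^ δ) := by rw [Finset.sum_const, nsmul_eq_mul]
  have h10 : (10 : ℝ) ^ δ = 2 ^ δ * 5 ^ δ := by
    rw [← Real.mul_rpow (by norm_num) (by norm_num)]
    norm_num
  rw [Real.div_rpow hs.le (by norm_num), Real.mul_rpow (by norm_num) hρ.le, ← mul_div_assoc,
    ← mul_div_assoc, div_le_iff₀ (by positivity)] at hcard
  rw [h10, div_mul_eq_mul_div, div_le_iff₀ (by positivity)]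
  linarith

variable [OpensMeasurableSpace Ω]

theorem card_mul_le_measureReal (hB : AhlforsBounds m δ a b r₀) {S : Finset Ω} {ρ : ℝ} (hρ : 0 < ρ)
    (hρ₀ : ρ ≤ r₀) (hS : (S : Set Ω).Pairwise (fun x y => 4 * ρ < dist x y)) {A : Set Ω}
    (hA : ∀ c ∈ S, Metric.ball c ρ ⊆ A) : S.card * (a * ρ ^ δ) ≤ m.real A := by
  have hdisj : (S : Set Ω).PairwiseDisjoint (fun c => Metric.ball c ρ) := fun x hx y hy hxy =>
    Metric.ball_disjoint_ball (by linarith [hS hx hy hxy])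
  calc S.card * (a * ρ ^ δ) = ∑ _ ∈ S, a * ρ ^ δ := by rw [Finset.sum_const, nsmul_eq_mul]
    _ ≤ ∑ c ∈ S, m.real (Metric.ball c ρ) := Finset.sum_le_sum fun _ _ => hB.lower _ ρ hρ hρ₀
    _ = m.real (⋃ c ∈ S, Metric.ball c ρ) :=
      (measureReal_biUnion_finset hdisj fun _ _ => measurableSet_ball).symm
    _ ≤ m.real A := measureReal_mono (iUnion₂_subset hA)

theorem card_mul_rpow_le (hB : AhlforsBounds m δ a b r₀) {S : Finset Ω} {ρ : ℝ} (hρ : 0 < ρ)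
    (hρ₀ : ρ ≤ r₀) (hS : (S : Set Ω).Pairwise (fun x y => 4 * ρ < dist x y)) {x : Ω} {R r : ℝ}
    (hSx : ∀ c ∈ S, dist c x ≤ R) (hr : 0 < r) (hRr : ρ + R ≤ r) :
    S.card * ρ ^ δ ≤ b / a * r ^ δ := by
  have hcard := (hB.card_mul_le_measureReal hρ hρ₀ hS (A := Metric.ball x r) fun c hc =>
    Metric.ball_subset_ball' (by linarith [hSx c hc])).trans (hB.upper x r hr)
  rw [div_mul_eq_mul_div, le_div_iff₀ hB.a_pos]
  linarith

end AhlforsBounds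

/-- A probability measure of density at most `bound` with respect to `m`, together with an open
set `carrier` of full measure. These are the mass distributions of the Cantor construction. -/
structure BoundedMeasure {Ω : Type*} [TopologicalSpace Ω] [MeasurableSpace Ω] (m : Measure Ω) where
  toMeasure : Measure Ω
  carrier : Set Ω
  bound : ℝ≥0
  isProbabilityMeasure : IsProbabilityMeasure toMeasure
  isOpen_carrier : IsOpen carrier
  measure_compl : toMeasure carrierᶜ = 0
  measure_le : toMeasure ≤ bound • m

namespace BoundedMeasure

attribute [instance] BoundedMeasure.isProbabilityMeasure

section Topological

variable {Ω : Type*} [TopologicalSpace Ω] [MeasurableSpace Ω] {m : Measure Ω}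

theorem bound_pos (P : BoundedMeasure m) : 0 < P.bound := by
  refine pos_iff_ne_zero.2 fun h => ?_
  have huniv := P.measure_le univ
  rw [h, zero_smul, measure_univ] at huniv
  exact one_ne_zero (le_antisymm huniv zero_le)

/-- The normalisation of a nonzero finite measure of bounded density. -/
noncomputable def ofMeasure (μ : Measure Ω) [IsFiniteMeasure μ] [NeZero μ] {A : Set Ω}
    (hA : IsOpen A) (hμA : μ Aᶜ = 0) {H : ℝ≥0} (hμ : μ ≤ H • m) : BoundedMeasure m where
  toMeasure := (μ univ)⁻¹ • μ
  carrier := A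
  bound := (μ univ).toNNReal⁻¹ * H
  isProbabilityMeasure := inferInstance
  isOpen_carrier := hA
  measure_compl := by simp [hμA]
  measure_le B := by
    simp only [Measure.smul_apply, smul_eq_mul, ENNReal.smul_def, ENNReal.coe_mul]
    rw [ENNReal.coe_inv (ENNReal.toNNReal_ne_zero.2 ⟨NeZero.ne _, measure_ne_top _ _⟩),
      ENNReal.coe_toNNReal (measure_ne_top _ _), mul_assoc]
    gcongr
    exact hμ B

variable [OpensMeasurableSpace Ω]

/-- The mass of `P` is passed on from the fibres of `π` to the measures `ν c`. -/
noncomputable def bind (P : BoundedMeasure m) (π : SimpleFunc Ω Ω) (ν : Ω → BoundedMeasure m) :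
    BoundedMeasure m :=
  have hmeas : Measurable fun z => (ν (π z)).toMeasure :=
    (π.map fun c => (ν c).toMeasure).measurable
  have hopen : IsOpen (⋃ z ∈ P.carrier, (ν (π z)).carrier) :=
    isOpen_biUnion fun _ _ => (ν _).isOpen_carrier
  { toMeasure := P.toMeasure.bind fun z => (ν (π z)).toMeasure
    carrier := ⋃ z ∈ P.carrier, (ν (π z)).carrier
    bound := π.range.sup fun c => (ν c).bound
    isProbabilityMeasure :=
      isProbabilityMeasure_bind hmeas.aemeasurable (ae_of_all _ fun _ => inferInstance)
    isOpen_carrier := hopen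
    measure_compl := by
      rw [Measure.bind_apply hopen.measurableSet.compl hmeas.aemeasurable,
        lintegral_eq_zero_of_ae_eq_zero]
      filter_upwards [mem_ae_iff.2 P.measure_compl] with z hz
      refine measure_mono_null (compl_subset_compl.2 ?_) (ν (π z)).measure_compl
      exact subset_biUnion_of_mem (u := fun z => (ν (π z)).carrier) hz
    measure_le := Measure.le_iff.2 fun B hB => by
      rw [Measure.bind_apply hB hmeas.aemeasurable]
      refine (lintegral_mono (g := fun _ => ((π.range.sup fun c => (ν c).bound) • m) B)
        fun z => ((ν (π z)).measure_le B).trans ?_).trans_eq (by simp)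
      simp only [Measure.smul_apply]
      gcongr
      exact Finset.le_sup (f := fun c => (ν c).bound) (π.mem_range_self z) }

end Topological

variable {Ω : Type*} [PseudoMetricSpace Ω] [MeasurableSpace Ω] {m : Measure Ω}

theorem measure_ball_le [IsFiniteMeasure m] {δ a b r₀ : ℝ} (P : BoundedMeasure m)
    (hB : AhlforsBounds m δ a b r₀) (x : Ω) {r : ℝ} (hr : 0 < r) :
    P.toMeasure (Metric.ball x r) ≤ ENNReal.ofReal (P.bound * (b * r ^ δ)) := by
  refine (P.measure_le _).trans ?_
  rw [Measure.smul_apply, ENNReal.smul_def, smul_eq_mul, ← ofReal_measureReal,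
    ENNReal.ofReal_mul P.bound.coe_nonneg, ENNReal.ofReal_coe_nnreal]
  gcongr
  exact hB.upper x r hr

variable [OpensMeasurableSpace Ω] (P : BoundedMeasure m) {π : SimpleFunc Ω Ω}
  {ν : Ω → BoundedMeasure m} {s : ℝ}

theorem bind_carrier_subset (hπ : ∀ x, dist (π x) x < s)
    (hν : ∀ c, (ν c).carrier ⊆ Metric.ball c s) :
    (P.bind π ν).carrier ⊆ Metric.thickening (2 * s) P.carrier :=
  iUnion₂_subset fun z hz y hy => Metric.mem_thickening_iff.2 ⟨z, hz, by
    linarith [dist_triangle y (π z) z, hπ z, Metric.mem_ball.1 (hν _ hy)]⟩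

theorem exists_thickening_bind_carrier_subset {E : Set Ω}
    (hν : ∀ c, ∃ τ > 0, Metric.thickening τ (ν c).carrier ⊆ E) :
    ∃ τ > 0, Metric.thickening τ (P.bind π ν).carrier ⊆ E := by
  choose τ hτ hνE using hν
  have : Nonempty Ω := P.toMeasure.nonempty_of_neZero
  obtain ⟨c, -, hc⟩ := π.range.exists_min_image τ ⟨_, π.mem_range_self (Classical.arbitrary Ω)⟩
  refine ⟨τ c, hτ c, fun z hz => ?_⟩
  obtain ⟨y, hy, hzy⟩ := Metric.mem_thickening_iff.1 hz
  obtain ⟨w, -, hyw⟩ := mem_iUnion₂.1 hy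
  exact hνE _ (Metric.mem_thickening_iff.2 ⟨y, hyw, hzy.trans_le (hc _ (π.mem_range_self w))⟩)

theorem bind_measure_ball_le (hπ : ∀ x, dist (π x) x < s)
    (hν : ∀ c, (ν c).carrier ⊆ Metric.ball c s) {x : Ω} {r : ℝ} {M : ℝ≥0∞}
    (hM : ∀ c, (ν c).toMeasure (Metric.ball x r) ≤ M) :
    (P.bind π ν).toMeasure (Metric.ball x r) ≤ M * P.toMeasure (Metric.ball x (r + 2 * s)) := by
  have hle : ∀ z, (ν (π z)).toMeasure (Metric.ball x r) ≤
      (Metric.ball x (r + 2 * s)).indicator (fun _ => M) z := by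
    intro z
    by_cases hz : z ∈ Metric.ball x (r + 2 * s)
    · exact (hM _).trans_eq (indicator_of_mem hz fun _ => M).symm
    rw [indicator_of_notMem hz, nonpos_iff_eq_zero]
    refine measure_mono_null (t := (ν (π z)).carrierᶜ) (fun y hy hyA => hz ?_)
      (ν (π z)).measure_compl
    rw [Metric.mem_ball] at hy ⊢
    linarith [dist_triangle4 z (π z) y x, Metric.mem_ball'.1 (hν _ hyA), hπ z, dist_comm z (π z)]
  calc (P.bind π ν).toMeasure (Metric.ball x r)
      = ∫⁻ z, (ν (π z)).toMeasure (Metric.ball x r) ∂P.toMeasure :=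
        Measure.bind_apply measurableSet_ball
          (π.map fun c => (ν c).toMeasure).measurable.aemeasurable
    _ ≤ ∫⁻ z, (Metric.ball x (r + 2 * s)).indicator (fun _ => M) z ∂P.toMeasure :=
        lintegral_mono hle
    _ = M * P.toMeasure (Metric.ball x (r + 2 * s)) :=
        lintegral_indicator_const measurableSet_ball M

end BoundedMeasure

/-- Every small ball `B(x₀, s)` carries a mass distribution with the Frostman bound
`ε s ^ (-δ) f(r)`, for arbitrarily small `ε`, whose carrier lies well inside `E`. This is a
quantitative form of the density of an open set `E`, used in place of density in a Baire category
argument. -/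
def IsFrostmanRich {Ω : Type*} [PseudoMetricSpace Ω] [MeasurableSpace Ω] (m : Measure Ω)
    (f : ℝ → ℝ) (δ : ℝ) (E : Set Ω) : Prop :=
  ∀ ε : ℝ, 0 < ε → ∃ s₀ : ℝ, 0 < s₀ ∧ ∀ s, 0 < s → s ≤ s₀ → ∀ x₀ : Ω,
    ∃ ν : BoundedMeasure m, ν.carrier ⊆ Metric.ball x₀ s ∧
      (∃ τ > 0, Metric.thickening τ ν.carrier ⊆ E) ∧
      ∀ x r, 0 < r → r ≤ s →
        ν.toMeasure (Metric.ball x r) ≤ ENNReal.ofReal (ε * s ^ (-δ) * f r)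

/-- A stage of the Cantor construction: a mass distribution with the Frostman bound `f(r) / η` at
the scales between `scale` and `t`, which is stable under perturbations of size `scale`. At the
smaller scales, the bound follows from that on the density (the factor `8` leaves room for the
next stage). -/
structure MassStage {Ω : Type*} [PseudoMetricSpace Ω] [MeasurableSpace Ω] (m : Measure Ω)
    (f : ℝ → ℝ) (δ b η t : ℝ) extends BoundedMeasure m where
  scale : ℝ
  scale_pos : 0 < scale
  scale_le : scale ≤ t
  bound_le : ∀ r, 0 < r → r ≤ scale → bound * (b * (8 * r) ^ δ) ≤ f r / η
  frostman : ∀ x r, scale ≤ r → r ≤ t →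
    toMeasure (Metric.ball x (r + scale)) ≤ ENNReal.ofReal (f r / η)

namespace MassStage

variable {Ω : Type*} [PseudoMetricSpace Ω] [MeasurableSpace Ω] {m : Measure Ω} {f : ℝ → ℝ}
  {δ a b r₀ η t : ℝ}

theorem exists_scale (hη : 0 < η) (hfδ : Tendsto (fun r : ℝ => r ^ (-δ) * f r) (𝓝[>] 0) atTop)
    (H : ℝ) : ∃ σ > 0, ∀ r, 0 < r → r ≤ σ → H * (b * (8 * r) ^ δ) ≤ f r / η := by
  obtain ⟨σ, hσ, hσf⟩ := exists_forall_mul_rpow_le hfδ (H * b * 8 ^ δ * η)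
  refine ⟨σ, hσ, fun r hr hrσ => (le_div_iff₀ hη).2 ((hσf r hr hrσ).trans_eq' ?_)⟩
  rw [Real.mul_rpow (by norm_num) hr.le]
  ring

variable [IsFiniteMeasure m]

theorem measure_ball_le (P : MassStage m f δ b η t) (hB : AhlforsBounds m δ a b r₀) (x : Ω)
    {r : ℝ} (hr : 0 < r) (hrt : r ≤ t) :
    P.toMeasure (Metric.ball x r) ≤ ENNReal.ofReal (f r / η) := by
  have hb := hB.b_pos
  have hδ := hB.δ_pos
  rcases le_total P.scale r with hσ | hσ
  · exact (measure_mono (Metric.ball_subset_ball (by linarith [P.scale_pos]))).trans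
      (P.frostman x r hσ hrt)
  · refine (P.toBoundedMeasure.measure_ball_le hB x hr).trans
      (ENNReal.ofReal_le_ofReal (le_trans ?_ (P.bound_le r hr hσ)))
    gcongr
    linarith

theorem exists_initial [NeZero m] (hB : AhlforsBounds m δ a b r₀) (hη : 0 < η)
    (hfδ : Tendsto (fun r : ℝ => r ^ (-δ) * f r) (𝓝[>] 0) atTop) :
    ∃ t > 0, Nonempty (MassStage m f δ b η t) := by
  have hb := hB.b_pos
  have hδ := hB.δ_pos
  let P : BoundedMeasure m :=
    .ofMeasure m isOpen_univ (by simp) (H := 1) (by rw [one_smul])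
  obtain ⟨t, ht, htf⟩ := exists_scale (b := b) hη hfδ P.bound
  refine ⟨t, ht, ⟨{ P with
    scale := t
    scale_pos := ht
    scale_le := le_rfl
    bound_le := htf
    frostman := fun x r hr hr' => ?_ }⟩⟩
  have hr0 : 0 < r := ht.trans_le hr
  refine (P.measure_ball_le hB x (by positivity)).trans
    (ENNReal.ofReal_le_ofReal (le_trans ?_ (htf r hr0 hr')))
  gcongr
  linarith

variable [OpensMeasurableSpace Ω]

/-- The constant in the Frostman bound which the measures `ν c` of the next stage must satisfy. -/
noncomputable def blockConst (P : MassStage m f δ b η t) : ℝ :=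
  1 / (P.bound * b * 8 ^ δ * η)

theorem bind_measure_ball_add_le_of_lt (P : MassStage m f δ b η t) (hB : AhlforsBounds m δ a b r₀)
    (hη : 0 < η) (hf : ∀ r, 0 < r → 0 < f r)
    (hfδ_anti : AntitoneOn (fun r : ℝ => r ^ (-δ) * f r) (Ioi 0)) {π : SimpleFunc Ω Ω}
    {ν : Ω → BoundedMeasure m} {s : ℝ} (hs : 0 < s)
    (hπ : ∀ x, dist (π x) x < s) (hν : ∀ c, (ν c).carrier ⊆ Metric.ball c s)
    (hνf : ∀ c x r, 0 < r → r ≤ s →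
      (ν c).toMeasure (Metric.ball x r) ≤ ENNReal.ofReal (P.blockConst * s ^ (-δ) * f r))
    (x : Ω) {r σ : ℝ} (hr : 0 < r) (hσr : σ ≤ r) (hrs : r < s / 2) :
    (P.toBoundedMeasure.bind π ν).toMeasure (Metric.ball x (r + σ)) ≤
      ENNReal.ofReal (f r / η) := by
  have hb := hB.b_pos
  have hfr := hf r hr
  have hH : (0 : ℝ) < P.bound := NNReal.coe_pos.2 P.bound_pos
  have hK : 0 < P.blockConst := by unfold blockConst; positivity
  calc (P.toBoundedMeasure.bind π ν).toMeasure (Metric.ball x (r + σ))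
      ≤ (P.toBoundedMeasure.bind π ν).toMeasure (Metric.ball x (2 * r)) :=
        measure_mono (Metric.ball_subset_ball (by linarith))
    _ ≤ ENNReal.ofReal (P.blockConst * s ^ (-δ) * f (2 * r)) *
          P.toMeasure (Metric.ball x (2 * r + 2 * s)) :=
        P.toBoundedMeasure.bind_measure_ball_le hπ hν fun c =>
          hνf c x (2 * r) (by positivity) (by linarith)
    _ ≤ ENNReal.ofReal (P.blockConst * s ^ (-δ) * (2 ^ δ * f r)) *
          ENNReal.ofReal (P.bound * (b * (4 * s) ^ δ)) := by
        gcongr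
        · exact apply_two_mul_le hfδ_anti hr
        · exact (measure_mono (Metric.ball_subset_ball (by linarith))).trans
            (P.toBoundedMeasure.measure_ball_le hB x (by positivity))
    _ = ENNReal.ofReal (f r / η) := by
        have h8 : (8 : ℝ) ^ δ = 2 ^ δ * 4 ^ δ := by
          rw [← Real.mul_rpow (by norm_num) (by norm_num)]
          norm_num
        rw [← ENNReal.ofReal_mul (by positivity), blockConst, h8, Real.rpow_neg hs.le,
          Real.mul_rpow (by norm_num) hs.le]
        congr 1
        field_simp

theorem bind_measure_ball_add_le_of_ge (P : MassStage m f δ b η t) (hB : AhlforsBounds m δ a b r₀)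
    {π : SimpleFunc Ω Ω} {ν : Ω → BoundedMeasure m} {s : ℝ} (hsσ : s ≤ P.scale / 8)
    (hπ : ∀ x, dist (π x) x < s) (hν : ∀ c, (ν c).carrier ⊆ Metric.ball c s) (x : Ω) {r σ : ℝ}
    (hr : 0 < r) (hrt : r ≤ t) (hσr : σ ≤ r) (hσs : σ ≤ s / 2) (hrs : s / 2 ≤ r) :
    (P.toBoundedMeasure.bind π ν).toMeasure (Metric.ball x (r + σ)) ≤
      ENNReal.ofReal (f r / η) := by
  have hle := P.toBoundedMeasure.bind_measure_ball_le hπ hν (x := x) (r := r + σ) (M := 1)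
    fun _ => prob_le_one
  rw [one_mul] at hle
  refine hle.trans ?_
  rcases le_total r P.scale with hrσ | hrσ
  · calc P.toMeasure (Metric.ball x (r + σ + 2 * s)) ≤ P.toMeasure (Metric.ball x (8 * r)) :=
          measure_mono (Metric.ball_subset_ball (by linarith))
      _ ≤ ENNReal.ofReal (P.bound * (b * (8 * r) ^ δ)) :=
          P.toBoundedMeasure.measure_ball_le hB x (by positivity)
      _ ≤ ENNReal.ofReal (f r / η) := ENNReal.ofReal_le_ofReal (P.bound_le r hr hrσ)
  · exact (measure_mono (Metric.ball_subset_ball (by linarith [P.scale_pos]))).trans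
      (P.frostman x r hrσ hrt)

theorem exists_next [CompactSpace Ω] (P : MassStage m f δ b η t)
    (hB : AhlforsBounds m δ a b r₀) (hη : 0 < η) (hf : ∀ r, 0 < r → 0 < f r)
    (hfδ : Tendsto (fun r : ℝ => r ^ (-δ) * f r) (𝓝[>] 0) atTop)
    (hfδ_anti : AntitoneOn (fun r : ℝ => r ^ (-δ) * f r) (Ioi 0)) {E : Set Ω}
    (hE : IsFrostmanRich m f δ E) :
    ∃ P' : MassStage m f δ b η t, Metric.thickening P'.scale P'.carrier ⊆ E ∧
      Metric.cthickening (P'.scale / 2) P'.carrier ⊆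
        Metric.cthickening (P.scale / 2) P.carrier := by
  have hb := hB.b_pos
  have hσ := P.scale_pos
  have hH : (0 : ℝ) < P.bound := NNReal.coe_pos.2 P.bound_pos
  obtain ⟨s₀, hs₀, hblock⟩ := hE P.blockConst (by unfold blockConst; positivity)
  obtain ⟨s, hs, hss₀, hsσ⟩ : ∃ s > 0, s ≤ s₀ ∧ s ≤ P.scale / 8 :=
    ⟨min s₀ (P.scale / 8), by positivity, min_le_left _ _, min_le_right _ _⟩
  choose ν hνs hνE hνf using hblock s hs hss₀
  have : Nonempty Ω := P.toMeasure.nonempty_of_neZero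
  obtain ⟨π, hπ⟩ := exists_simpleFunc_dist_lt (X := Ω) hs
  obtain ⟨τ, hτ, hτE⟩ := P.toBoundedMeasure.exists_thickening_bind_carrier_subset (π := π) hνE
  obtain ⟨σ₁, hσ₁, hσ₁f⟩ := exists_scale (b := b) hη hfδ (P.toBoundedMeasure.bind π ν).bound
  obtain ⟨σ, hσ0, hσσ₁, hσs, hσt⟩ : ∃ σ > 0, σ ≤ σ₁ ∧ σ ≤ s / 2 ∧ σ ≤ τ :=
    ⟨min σ₁ (min (s / 2) τ), by positivity, min_le_left _ _,
      (min_le_right _ _).trans (min_le_left _ _), (min_le_right _ _).trans (min_le_right _ _)⟩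
  refine ⟨{ P.toBoundedMeasure.bind π ν with
    scale := σ
    scale_pos := hσ0
    scale_le := by linarith [P.scale_le]
    bound_le := fun r hr hrσ => hσ₁f r hr (hrσ.trans hσσ₁)
    frostman := fun x r hr hrt => (lt_or_ge r (s / 2)).elim
      (P.bind_measure_ball_add_le_of_lt hB hη hf hfδ_anti hs hπ hνs hνf x (hσ0.trans_le hr) hr)
      (P.bind_measure_ball_add_le_of_ge hB hsσ hπ hνs x (hσ0.trans_le hr) hrt hr hσs) },
    (Metric.thickening_mono hσt _).trans hτE, ?_⟩
  calc Metric.cthickening (σ / 2) (P.toBoundedMeasure.bind π ν).carrier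
      ⊆ Metric.cthickening (σ / 2) (Metric.thickening (2 * s) P.carrier) :=
        Metric.cthickening_subset_of_subset _ (P.toBoundedMeasure.bind_carrier_subset hπ hνs)
    _ ⊆ Metric.cthickening (σ / 2 + 2 * s) P.carrier :=
        Metric.cthickening_thickening_subset (by positivity) _ _
    _ ⊆ Metric.cthickening (P.scale / 2) P.carrier := Metric.cthickening_mono (by linarith) _

end MassStage

section Hausdorff

variable {Ω : Type*} [MetricSpace Ω] [MeasurableSpace Ω] {m : Measure Ω} {f : ℝ → ℝ}
  {δ a b r₀ η t : ℝ}

theorem MassStage.ofReal_le_tsum [IsFiniteMeasure m] (P : MassStage m f δ b η t)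
    (hB : AhlforsBounds m δ a b r₀) (hη : 0 < η) {𝒞 : Set (Ω × ℝ)} (h𝒞 : 𝒞.Countable)
    (hrad : ∀ p ∈ 𝒞, 0 < p.2 ∧ p.2 ≤ t) (hcover : P.carrier ⊆ ⋃ p ∈ 𝒞, Metric.ball p.1 p.2) :
    ENNReal.ofReal η ≤ ∑' p : 𝒞, ENNReal.ofReal (f (p : Ω × ℝ).2) := by
  have hcarrier : P.toMeasure P.carrier = 1 := by
    rw [← measure_univ (μ := P.toMeasure)]
    exact measure_eq_measure_of_null_sdiff (subset_univ _) (by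
      rw [← compl_eq_univ_sdiff]; exact P.measure_compl)
  calc ENNReal.ofReal η = ENNReal.ofReal η * P.toMeasure P.carrier := by rw [hcarrier, mul_one]
    _ ≤ ENNReal.ofReal η * ∑' p : 𝒞, P.toMeasure (Metric.ball (p : Ω × ℝ).1 (p : Ω × ℝ).2) := by
        gcongr
        exact (measure_mono hcover).trans (measure_biUnion_le _ h𝒞 _)
    _ ≤ ∑' p : 𝒞, ENNReal.ofReal (f (p : Ω × ℝ).2) := by
        rw [← ENNReal.tsum_mul_left]
        refine ENNReal.tsum_le_tsum fun p => ?_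
        obtain ⟨hp, hpt⟩ := hrad p p.2
        calc ENNReal.ofReal η * P.toMeasure (Metric.ball (p : Ω × ℝ).1 (p : Ω × ℝ).2)
            ≤ ENNReal.ofReal η * ENNReal.ofReal (f (p : Ω × ℝ).2 / η) := by
              gcongr
              exact P.measure_ball_le hB _ hp hpt
          _ = ENNReal.ofReal (f (p : Ω × ℝ).2) := by
              rw [← ENNReal.ofReal_mul hη.le, mul_div_cancel₀ _ hη.ne']

theorem hausdorffMeasureFun_iInter_eq_top [CompactSpace Ω] [OpensMeasurableSpace Ω]
    [IsFiniteMeasure m] [NeZero m] (hB : AhlforsBounds m δ a b r₀) (hf : ∀ r, 0 < r → 0 < f r)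
    (hfδ : Tendsto (fun r : ℝ => r ^ (-δ) * f r) (𝓝[>] 0) atTop)
    (hfδ_anti : AntitoneOn (fun r : ℝ => r ^ (-δ) * f r) (Ioi 0)) {U : ℕ → Set Ω}
    (hU : ∀ n, IsFrostmanRich m f δ (U n)) : hausdorffMeasureFun f (⋂ n, U n) = ⊤ := by
  refine ENNReal.eq_top_of_forall_nnreal_le fun η₀ => ?_
  obtain ⟨η, hη, hη₀⟩ : ∃ η > 0, (η₀ : ℝ≥0∞) ≤ ENNReal.ofReal η :=
    ⟨η₀ + 1, by positivity, by
      rw [← ENNReal.ofReal_coe_nnreal]; exact ENNReal.ofReal_le_ofReal (by linarith)⟩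
  obtain ⟨t, ht, ⟨P₀⟩⟩ := MassStage.exists_initial hB hη hfδ
  choose next hnextU hnext using fun N (P : MassStage m f δ b η t) =>
    P.exists_next hB hη hf hfδ hfδ_anti (hU N)
  let P : ℕ → MassStage m f δ b η t := fun n => Nat.rec P₀ next n
  set F : ℕ → Set Ω := fun n => Metric.cthickening ((P n).scale / 2) (P n).carrier
  have hF_anti : Antitone F := antitone_nat_of_succ_le fun n => hnext n (P n)
  have hFU : ⋂ n, F n ⊆ ⋂ n, U n := subset_iInter fun n => (iInter_subset F (n + 1)).trans <|
    (Metric.cthickening_subset_thickening' (P (n + 1)).scale_pos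
      (half_lt_self (P (n + 1)).scale_pos) _).trans (hnextU n (P n))
  refine hη₀.trans (le_trans (le_iInf₂ fun 𝒞 h𝒞 => le_iInf₂ fun hrad hcover => ?_)
    (le_iSup₂ (f := fun t (_ : 0 < t) => hausdorffPre f t (⋂ n, U n)) t ht))
  obtain ⟨n, hn⟩ := exists_subset_nhds_of_compactSpace hF_anti.directed_ge
    (fun _ => Metric.isClosed_cthickening) fun x hx =>
      (isOpen_biUnion fun p _ => Metric.isOpen_ball).mem_nhds (hcover (hFU hx))
  exact (P n).ofReal_le_tsum hB hη h𝒞 hrad ((Metric.self_subset_cthickening _).trans hn)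

end Hausdorff

theorem hausdorffMeasureFun_mono {Ω : Type*} [MetricSpace Ω] (f : ℝ → ℝ) {F F' : Set Ω}
    (h : F ⊆ F') : hausdorffMeasureFun f F ≤ hausdorffMeasureFun f F' := by
  refine iSup₂_mono fun t _ => ?_
  unfold hausdorffPre
  refine le_iInf₂ fun 𝒞 h𝒞 => le_iInf₂ fun hrad hcov => ?_
  exact iInf₂_le_of_le 𝒞 h𝒞 (iInf₂_le_of_le hrad (h.trans hcov) le_rfl)

section CondMixture

variable {ι Ω : Type*} [MeasurableSpace Ω] {m : Measure Ω} {s : Finset ι} {w : ι → ℝ}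
  {T : ι → Set Ω}

/-- The combination with weights `w i` of the measures `m` conditioned on the sets `T i`. -/
noncomputable def condMixture (m : Measure Ω) (s : Finset ι) (w : ι → ℝ) (T : ι → Set Ω) :
    Measure Ω :=
  ∑ i ∈ s, ENNReal.ofReal (w i) • m[|T i]

instance : IsFiniteMeasure (condMixture m s w T) := by
  unfold condMixture
  have (i : ι) : IsFiniteMeasure (ENNReal.ofReal (w i) • m[|T i]) :=
    Measure.smul_finite _ ENNReal.ofReal_ne_top
  infer_instance

theorem condMixture_apply (hw : ∀ i ∈ s, 0 ≤ w i) (B : Set Ω) :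
    condMixture m s w T B = ENNReal.ofReal (∑ i ∈ s, w i * m[|T i].real B) := by
  rw [condMixture, Measure.finsetSum_apply, ENNReal.ofReal_sum_of_nonneg
    fun i hi => mul_nonneg (hw i hi) measureReal_nonneg]
  refine Finset.sum_congr rfl fun i hi => ?_
  rw [Measure.smul_apply, smul_eq_mul, ENNReal.ofReal_mul (hw i hi), ofReal_measureReal]

theorem condMixture_compl_biUnion (hT : ∀ i ∈ s, MeasurableSet (T i)) :
    condMixture m s w T (⋃ i ∈ s, T i)ᶜ = 0 := by
  rw [condMixture, Measure.finsetSum_apply]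
  refine Finset.sum_eq_zero fun i hi => ?_
  have hempty : T i ∩ (⋃ i ∈ s, T i)ᶜ = ∅ :=
    (disjoint_compl_right_iff_subset.2 (subset_biUnion_of_mem (u := T) hi)).inter_eq
  rw [Measure.smul_apply, cond_apply (hT i hi), hempty, measure_empty, mul_zero, smul_zero]

theorem exists_condMixture_le_smul (hT : ∀ i ∈ s, m (T i) ≠ 0) :
    ∃ H : ℝ≥0, condMixture m s w T ≤ H • m := by
  refine ⟨∑ i ∈ s, (w i).toNNReal * (m (T i))⁻¹.toNNReal, ?_⟩
  rw [condMixture, Finset.sum_smul]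
  refine Finset.sum_le_sum fun i hi => Measure.le_iff.2 fun B _ => ?_
  simp only [Measure.smul_apply, smul_eq_mul, ENNReal.smul_def, ENNReal.coe_mul,
    ProbabilityTheory.cond, ENNReal.coe_toNNReal (ENNReal.inv_ne_top.2 (hT i hi)), ENNReal.ofReal,
    mul_assoc]
  gcongr
  exact Measure.restrict_le_self

end CondMixture

/-- The part `T` of the `t`-neighbourhood of a resonant set which lies near a point `c` of it, seen
from the larger scale `ρ`. If the resonant set has dimension `γ`, the estimates hold for `p = δ - γ`
and the weight `f(t) t ^ (-γ) ρ ^ (γ - δ)`. -/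
structure IsPiece {Ω : Type*} [PseudoMetricSpace Ω] [MeasurableSpace Ω] (m : Measure Ω) (f : ℝ → ℝ)
    (δ p C ρ t weight : ℝ) (c : Ω) (T : Set Ω) : Prop where
  isOpen : IsOpen T
  subset_ball : T ⊆ Metric.ball c (ρ / 2)
  measure_ne_zero : m T ≠ 0
  cond_ball_le : ∀ x r, 0 < r → r ≤ ρ → weight * (ρ ^ δ * m[|T].real (Metric.ball x r)) ≤ C * f r
  thickening_le : ∀ w, 0 < w → w ≤ ρ / 2 →
    m.real (Metric.thickening w T) ≤ C * ρ ^ δ * ((t / ρ) ^ p + (w / ρ) ^ p)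

/-- A sequence of levels: at level `n`, the balls of radius `ρ n` around the points of `centres n`
fill a fixed proportion of every small ball, and each of them contains a piece. -/
structure LevelSystem {Ω : Type*} [PseudoMetricSpace Ω] [MeasurableSpace Ω] (m : Measure Ω)
    (f : ℝ → ℝ) (δ p κ C : ℝ) where
  ρ : ℕ → ℝ
  t : ℕ → ℝ
  weight : ℕ → ℝ
  centres : ℕ → Set Ω
  piece : ℕ → Ω → Set Ω
  ρ_pos : ∀ n, 0 < ρ n
  ρ_lim : Tendsto ρ atTop (𝓝 0)
  t_pos : ∀ n, 0 < t n
  t_le : ∀ n, t n ≤ ρ n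
  weight_nonneg : ∀ n, 0 ≤ weight n
  ratio_le : ∀ n, (t n / ρ n) ^ p * f (t n) ≤ weight n * t n ^ δ
  isPiece : ∀ n, ∀ c ∈ centres n, IsPiece m f δ p C (ρ n) (t n) (weight n) c (piece n c)
  ubiquitous : ∃ r₁ > 0, ∀ x r, 0 < r → r ≤ r₁ → ∀ᶠ n in atTop, κ * m.real (Metric.ball x r) ≤
    m.real (Metric.ball x r ∩ ⋃ c ∈ centres n, Metric.ball c (ρ n))

namespace LevelSystem

section Basic

variable {Ω : Type*} [PseudoMetricSpace Ω] [MeasurableSpace Ω] {m : Measure Ω} {f : ℝ → ℝ}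
  {δ p κ C : ℝ}

/-- The `t n`-neighbourhood of the union of the pieces of level `n`. -/
def target (L : LevelSystem m f δ p κ C) (n : ℕ) : Set Ω :=
  ⋃ c ∈ L.centres n, Metric.thickening (L.t n) (L.piece n c)

/-- The subsequence of levels given by `φ`. -/
def comp (L : LevelSystem m f δ p κ C) {φ : ℕ → ℕ} (hφ : StrictMono φ) :
    LevelSystem m f δ p κ C where
  ρ := L.ρ ∘ φ
  t := L.t ∘ φ
  weight := L.weight ∘ φ
  centres := L.centres ∘ φ
  piece := L.piece ∘ φ
  ρ_pos n := L.ρ_pos (φ n)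
  ρ_lim := L.ρ_lim.comp hφ.tendsto_atTop
  t_pos n := L.t_pos (φ n)
  t_le n := L.t_le (φ n)
  weight_nonneg n := L.weight_nonneg (φ n)
  ratio_le n := L.ratio_le (φ n)
  isPiece n := L.isPiece (φ n)
  ubiquitous := by
    obtain ⟨r₁, hr₁, h⟩ := L.ubiquitous
    exact ⟨r₁, hr₁, fun x r hr hr' => hφ.tendsto_atTop.eventually (h x r hr hr')⟩

/-- The scales decrease so fast that the levels hardly interact: the pieces of level `i` are barely
enlarged when they are thickened by a later scale. -/
structure IsLacunary (L : LevelSystem m f δ p κ C) (ζ : ℝ) : Prop where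
  ρ_succ_le : ∀ n, L.ρ (n + 1) ≤ L.ρ n / 8
  sum_le : ∀ k, ∑ i ∈ Finset.range k, (4 * L.ρ k / L.ρ i) ^ p ≤ ζ

/-- A choice of well separated centres at every level in the ball `B(x₀, s)`, whose number has the
largest possible order of magnitude. -/
structure IsPacking (L : LevelSystem m f δ p κ C) (x₀ : Ω) (s c₃ : ℝ) (S : ℕ → Finset Ω) :
    Prop where
  mem : ∀ k, ∀ c ∈ S k, c ∈ L.centres k
  dist_le : ∀ k, ∀ c ∈ S k, dist c x₀ ≤ 3 * s / 4
  separated : ∀ k, (S k : Set Ω).Pairwise fun c c' => 4 * L.ρ k < dist c c'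
  le_card : ∀ k, c₃ * s ^ δ ≤ (S k).card * L.ρ k ^ δ
  ρ_le : ∀ k, L.ρ k ≤ s / 4

/-- The chosen centres of level `k` whose `3 ρ k`-balls avoid the pieces of all earlier levels. -/
noncomputable def goodCentres (L : LevelSystem m f δ p κ C) (S : ℕ → Finset Ω) (k : ℕ) :
    Finset Ω :=
  open Classical in
  (S k).filter fun c => ∀ i < k, ∀ c' ∈ S i, Disjoint (Metric.ball c (3 * L.ρ k)) (L.piece i c')

variable (L : LevelSystem m f δ p κ C) {S : ℕ → Finset Ω}

theorem goodCentres_subset (k : ℕ) : L.goodCentres S k ⊆ S k :=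
  by classical exact Finset.filter_subset _ _

theorem disjoint_of_mem_goodCentres {i k : ℕ} {c c' : Ω} (hc : c ∈ L.goodCentres S k)
    (hik : i < k) (hc' : c' ∈ S i) : Disjoint (Metric.ball c (3 * L.ρ k)) (L.piece i c') := by
  classical exact (Finset.mem_filter.1 hc).2 i hik c' hc'

theorem exists_not_disjoint_of_notMem_goodCentres {k : ℕ} {c : Ω} (hc : c ∈ S k)
    (hc' : c ∉ L.goodCentres S k) :
    ∃ i < k, ∃ c' ∈ S i, ¬ Disjoint (Metric.ball c (3 * L.ρ k)) (L.piece i c') := by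
  classical
  rw [goodCentres, Finset.mem_filter] at hc'
  push Not at hc'
  exact hc' hc

variable {L} in
theorem IsLacunary.ρ_le_div_eight {ζ : ℝ} (hL : L.IsLacunary ζ) {i k : ℕ} (hik : i < k) :
    L.ρ k ≤ L.ρ i / 8 :=
  (antitone_nat_of_succ_le (fun n => by linarith [hL.ρ_succ_le n, L.ρ_pos n]) hik).trans
    (hL.ρ_succ_le i)

variable {L} in
theorem IsLacunary.comp_add_left {ζ : ℝ} (hL : L.IsLacunary ζ) (N : ℕ) :
    (L.comp (strictMono_id.const_add N)).IsLacunary ζ where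
  ρ_succ_le n := hL.ρ_succ_le (N + n)
  sum_le k := by
    have hsum := hL.sum_le (N + k)
    rw [Finset.sum_range_add] at hsum
    have hpos (i : ℕ) : 0 ≤ (4 * L.ρ (N + k) / L.ρ i) ^ p :=
      Real.rpow_nonneg (div_nonneg (mul_nonneg zero_le_four (L.ρ_pos _).le) (L.ρ_pos i).le) p
    exact (le_add_of_nonneg_left (Finset.sum_nonneg fun i _ => hpos i)).trans hsum

theorem IsPacking.eq_of_meets_ball {L : LevelSystem m f δ p κ C} {x₀ : Ω} {s c₃ : ℝ}
    (hS : L.IsPacking x₀ s c₃ S) {x : Ω} {r : ℝ}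
    {q q' : Σ _ : ℕ, Ω} (hq : q.2 ∈ L.goodCentres S q.1) (hq' : q'.2 ∈ L.goodCentres S q'.1)
    (hr : r ≤ L.ρ q.1) (hr' : r ≤ L.ρ q'.1)
    (h : ¬ Disjoint (L.piece q.1 q.2) (Metric.ball x r))
    (h' : ¬ Disjoint (L.piece q'.1 q'.2) (Metric.ball x r)) : q = q' := by
  wlog hle : q.1 ≤ q'.1 generalizing q q'
  · exact (this hq' hq hr' hr h' h (le_of_not_ge hle)).symm
  obtain ⟨k, c⟩ := q
  obtain ⟨k', c'⟩ := q'
  simp only at hle hq hq' hr hr' h h'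
  have hcS := L.goodCentres_subset k hq
  have hcS' := L.goodCentres_subset k' hq'
  obtain ⟨z, hzT, hz⟩ := Set.not_disjoint_iff.1 h
  obtain ⟨z', hzT', hz'⟩ := Set.not_disjoint_iff.1 h'
  have hzc := (L.isPiece k c (hS.mem k c hcS)).subset_ball hzT
  have hzc' := (L.isPiece k' c' (hS.mem k' c' hcS')).subset_ball hzT'
  rw [Metric.mem_ball] at hz hzc
  rw [Metric.mem_ball'] at hz' hzc'
  have hρ' := L.ρ_pos k'
  have hzz' : dist z c' < 3 * L.ρ k' := by
    linarith [dist_triangle4 z x z' c', dist_comm c' z']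
  rcases hle.eq_or_lt with rfl | hlt
  · by_contra hne
    have hcc' : 4 * L.ρ k < dist c c' := hS.separated k hcS hcS' fun h => hne (h ▸ rfl)
    linarith [dist_triangle_left c c' z]
  · exact absurd hzT (Set.disjoint_left.1 (L.disjoint_of_mem_goodCentres hq' hlt hcS) hzz')

theorem cond_ball_eq_zero [OpensMeasurableSpace Ω] {k : ℕ} {c : Ω} {B : Set Ω}
    (hc : c ∈ L.centres k) (h : Disjoint (L.piece k c) B) : m[|L.piece k c].real B = 0 := by
  rw [measureReal_def, cond_apply (L.isPiece k c hc).isOpen.measurableSet, h.inter_eq,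
    measure_empty, mul_zero, ENNReal.toReal_zero]

theorem IsPacking.sum_cond_ball_le_of_le [OpensMeasurableSpace Ω] {L : LevelSystem m f δ p κ C}
    {x₀ : Ω} {s c₃ : ℝ} (hS : L.IsPacking x₀ s c₃ S) (hC : 0 ≤ C) (hf : ∀ r, 0 < r → 0 < f r)
    {I : Finset ℕ} {x : Ω} {r : ℝ} (hr : 0 < r) (hI : ∀ k ∈ I, r ≤ L.ρ k) :
    ∑ k ∈ I, ∑ c ∈ L.goodCentres S k,
      L.weight k * (L.ρ k ^ δ * m[|L.piece k c].real (Metric.ball x r)) ≤ C * f r := by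
  have hmem : ∀ q ∈ I.sigma (L.goodCentres S), q.2 ∈ L.centres q.1 := fun q hq =>
    hS.mem _ _ (L.goodCentres_subset _ (Finset.mem_sigma.1 hq).2)
  have hmeet : ∀ q ∈ I.sigma (L.goodCentres S),
      L.weight q.1 * (L.ρ q.1 ^ δ * m[|L.piece q.1 q.2].real (Metric.ball x r)) ≠ 0 →
        ¬ Disjoint (L.piece q.1 q.2) (Metric.ball x r) := fun q hq hne hdisj =>
    hne (by rw [L.cond_ball_eq_zero (hmem q hq) hdisj, mul_zero, mul_zero])
  rw [Finset.sum_sigma']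
  exact sum_le_of_card_ne_zero_le_one (mul_nonneg hC (hf r hr).le)
    (fun q hq => (L.isPiece _ _ (hmem q hq)).cond_ball_le x r hr (hI _ (Finset.mem_sigma.1 hq).1))
    fun q hq q' hq' hne hne' => hS.eq_of_meets_ball (Finset.mem_sigma.1 hq).2
      (Finset.mem_sigma.1 hq').2 (hI _ (Finset.mem_sigma.1 hq).1) (hI _ (Finset.mem_sigma.1 hq').1)
      (hmeet q hq hne) (hmeet q' hq' hne')

end Basic

variable {Ω : Type*} [PseudoMetricSpace Ω] [MeasurableSpace Ω] [OpensMeasurableSpace Ω]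
  {m : Measure Ω} [IsFiniteMeasure m] {f : ℝ → ℝ} {δ p κ C a b r₀ : ℝ}
  {L : LevelSystem m f δ p κ C} {S : ℕ → Finset Ω} {x₀ : Ω} {s c₃ : ℝ}

theorem IsPacking.card_mul_rpow_le (hS : L.IsPacking x₀ s c₃ S) (hB : AhlforsBounds m δ a b r₀)
    (hs : 0 < s) (hsr₀ : s ≤ r₀) (k : ℕ) : (S k).card * L.ρ k ^ δ ≤ b / a * s ^ δ :=
  hB.card_mul_rpow_le (L.ρ_pos k) (by linarith [hS.ρ_le k]) (hS.separated k) (hS.dist_le k) hs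
    (by linarith [hS.ρ_le k])

theorem IsPacking.measureReal_biUnion_thickening_le (hS : L.IsPacking x₀ s c₃ S)
    (hB : AhlforsBounds m δ a b r₀) (hC : 0 ≤ C) (hs : 0 < s) (hsr₀ : s ≤ r₀) {i : ℕ} {w : ℝ}
    (hw : 0 < w) (hwρ : w ≤ L.ρ i / 2) :
    m.real (⋃ c ∈ S i, Metric.thickening w (L.piece i c)) ≤
      C * (b / a * s ^ δ) * ((L.t i / L.ρ i) ^ p + (w / L.ρ i) ^ p) := by
  have hρ := L.ρ_pos i
  have ht := L.t_pos i
  calc m.real (⋃ c ∈ S i, Metric.thickening w (L.piece i c))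
      ≤ ∑ c ∈ S i, m.real (Metric.thickening w (L.piece i c)) := measureReal_biUnion_finset_le _ _
    _ ≤ ∑ _ ∈ S i, C * L.ρ i ^ δ * ((L.t i / L.ρ i) ^ p + (w / L.ρ i) ^ p) :=
        Finset.sum_le_sum fun c hc => (L.isPiece i c (hS.mem i c hc)).thickening_le w hw hwρ
    _ = C * ((S i).card * L.ρ i ^ δ) * ((L.t i / L.ρ i) ^ p + (w / L.ρ i) ^ p) := by
        rw [Finset.sum_const, nsmul_eq_mul]
        ring
    _ ≤ C * (b / a * s ^ δ) * ((L.t i / L.ρ i) ^ p + (w / L.ρ i) ^ p) := by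
        refine mul_le_mul_of_nonneg_right (mul_le_mul_of_nonneg_left ?_ hC) (by positivity)
        exact hS.card_mul_rpow_le hB hs hsr₀ i

theorem IsPacking.card_sdiff_goodCentres_mul_rpow_le (hS : L.IsPacking x₀ s c₃ S)
    (hB : AhlforsBounds m δ a b r₀) (hC : 0 ≤ C) (hs : 0 < s) (hsr₀ : s ≤ r₀)
    {ζ : ℝ} (hL : L.IsLacunary ζ) {k : ℕ}
    (hsum : ∑ i ∈ Finset.range k, (L.t i / L.ρ i) ^ p ≤ ζ) :
    open Classical in
    (S k \ L.goodCentres S k).card * (a * L.ρ k ^ δ) ≤ C * (b / a * s ^ δ) * (ζ + ζ) := by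
  classical
  have ha := hB.a_pos
  have hb := hB.b_pos
  have hρ := L.ρ_pos k
  -- A bad centre is close to a piece of an earlier level, and these neighbourhoods have small total
  -- measure.
  have hsubset : ∀ c ∈ S k \ L.goodCentres S k, Metric.ball c (L.ρ k) ⊆
      ⋃ i ∈ Finset.range k, ⋃ c' ∈ S i, Metric.thickening (4 * L.ρ k) (L.piece i c') := by
    intro c hc y hy
    obtain ⟨hcS, hcbad⟩ := Finset.mem_sdiff.1 hc
    obtain ⟨i, hi, c', hc', hmeet⟩ := L.exists_not_disjoint_of_notMem_goodCentres hcS hcbad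
    obtain ⟨z, hz, hzT⟩ := Set.not_disjoint_iff.1 hmeet
    refine mem_iUnion₂_of_mem (Finset.mem_range.2 hi) (mem_iUnion₂_of_mem hc'
      (Metric.mem_thickening_iff.2 ⟨z, hzT, ?_⟩))
    linarith [dist_triangle_right y z c, Metric.mem_ball.1 hy, Metric.mem_ball.1 hz]
  calc (S k \ L.goodCentres S k).card * (a * L.ρ k ^ δ)
      ≤ m.real (⋃ i ∈ Finset.range k, ⋃ c' ∈ S i,
          Metric.thickening (4 * L.ρ k) (L.piece i c')) :=
        hB.card_mul_le_measureReal hρ (by linarith [hS.ρ_le k])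
          ((hS.separated k).mono (Finset.coe_subset.2 Finset.sdiff_subset)) hsubset
    _ ≤ ∑ i ∈ Finset.range k, m.real (⋃ c' ∈ S i,
          Metric.thickening (4 * L.ρ k) (L.piece i c')) := measureReal_biUnion_finset_le _ _
    _ ≤ ∑ i ∈ Finset.range k, C * (b / a * s ^ δ) *
          ((L.t i / L.ρ i) ^ p + (4 * L.ρ k / L.ρ i) ^ p) :=
        Finset.sum_le_sum fun i hi => hS.measureReal_biUnion_thickening_le hB hC hs hsr₀
          (by positivity) (by linarith [hL.ρ_le_div_eight (Finset.mem_range.1 hi)])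
    _ ≤ C * (b / a * s ^ δ) * (ζ + ζ) := by
        rw [← Finset.mul_sum, Finset.sum_add_distrib]
        gcongr
        exact hL.sum_le k

theorem IsPacking.le_card_goodCentres (hS : L.IsPacking x₀ s c₃ S)
    (hB : AhlforsBounds m δ a b r₀) (hC : 0 ≤ C) (hs : 0 < s) (hsr₀ : s ≤ r₀)
    {ζ : ℝ} (hL : L.IsLacunary ζ) {k : ℕ}
    (hsum : ∑ i ∈ Finset.range k, (L.t i / L.ρ i) ^ p ≤ ζ)
    (hζ : 4 * C * b * ζ ≤ c₃ * a ^ 2) :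
    c₃ / 2 * s ^ δ ≤ (L.goodCentres S k).card * L.ρ k ^ δ := by
  classical
  have ha := hB.a_pos
  have hbad : a * ((S k \ L.goodCentres S k).card * L.ρ k ^ δ) ≤ a * (c₃ / 2 * s ^ δ) := by
    calc a * ((S k \ L.goodCentres S k).card * L.ρ k ^ δ)
        = (S k \ L.goodCentres S k).card * (a * L.ρ k ^ δ) := by ring
      _ ≤ C * (b / a * s ^ δ) * (ζ + ζ) :=
          hS.card_sdiff_goodCentres_mul_rpow_le hB hC hs hsr₀ hL hsum
      _ = (4 * C * b * ζ) * (s ^ δ / (2 * a)) := by field_simp; ring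
      _ ≤ (c₃ * a ^ 2) * (s ^ δ / (2 * a)) := by gcongr
      _ = a * (c₃ / 2 * s ^ δ) := by field_simp
  have hcard : ((S k \ L.goodCentres S k).card : ℝ) + (L.goodCentres S k).card = (S k).card := by
    exact_mod_cast Finset.card_sdiff_add_card_eq_card (L.goodCentres_subset k)
  have hS_card := hS.le_card k
  rw [← hcard, add_mul] at hS_card
  linarith [le_of_mul_le_mul_left hbad ha]

theorem IsPacking.sum_cond_ball_le_of_ge (hS : L.IsPacking x₀ s c₃ S)
    (hB : AhlforsBounds m δ a b r₀) {k : ℕ} (hρ₀ : L.ρ k ≤ r₀) {x : Ω} {r : ℝ} (hr : L.ρ k ≤ r) :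
    ∑ c ∈ L.goodCentres S k, L.ρ k ^ δ * m[|L.piece k c].real (Metric.ball x r) ≤
      b * 3 ^ δ / a * r ^ δ := by
  classical
  have hρ := L.ρ_pos k
  have hr0 : 0 < r := hρ.trans_le hr
  set near := (L.goodCentres S k).filter fun c => dist c x ≤ 2 * r
  have hnearS : near ⊆ S k := (Finset.filter_subset _ _).trans (L.goodCentres_subset k)
  have hfar : ∀ c ∈ L.goodCentres S k, c ∉ near →
      L.ρ k ^ δ * m[|L.piece k c].real (Metric.ball x r) = 0 := by
    intro c hc hfar
    have hcZ := hS.mem k c (L.goodCentres_subset k hc)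
    have hdist : 2 * r < dist c x := not_le.1 fun h => hfar (Finset.mem_filter.2 ⟨hc, h⟩)
    rw [L.cond_ball_eq_zero hcZ, mul_zero]
    exact (Metric.ball_disjoint_ball (by linarith)).mono_left (L.isPiece k c hcZ).subset_ball
  have hprob (c : Ω) : m[|L.piece k c].real (Metric.ball x r) ≤ 1 := measureReal_le_one
  calc ∑ c ∈ L.goodCentres S k, L.ρ k ^ δ * m[|L.piece k c].real (Metric.ball x r)
      = ∑ c ∈ near, L.ρ k ^ δ * m[|L.piece k c].real (Metric.ball x r) :=
        (Finset.sum_subset (Finset.filter_subset _ _) hfar).symm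
    _ ≤ ∑ _ ∈ near, L.ρ k ^ δ := Finset.sum_le_sum fun c _ =>
        mul_le_of_le_one_right (by positivity) (hprob c)
    _ = near.card * L.ρ k ^ δ := by rw [Finset.sum_const, nsmul_eq_mul]
    _ ≤ b / a * (3 * r) ^ δ := hB.card_mul_rpow_le hρ hρ₀
        ((hS.separated k).mono (Finset.coe_subset.2 hnearS))
        (fun c hc => (Finset.mem_filter.1 hc).2) (by positivity) (by linarith)
    _ = b * 3 ^ δ / a * r ^ δ := by
        rw [Real.mul_rpow (by norm_num) hr0.le]
        ring

theorem IsPacking.sum_cond_ball_le (hS : L.IsPacking x₀ s c₃ S) (hB : AhlforsBounds m δ a b r₀)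
    (hC : 0 ≤ C) (hsr₀ : s ≤ r₀) (hf : ∀ r, 0 < r → 0 < f r) (I : Finset ℕ) {x : Ω} {r : ℝ}
    (hr : 0 < r) :
    ∑ k ∈ I, ∑ c ∈ L.goodCentres S k,
        L.weight k * (L.ρ k ^ δ * m[|L.piece k c].real (Metric.ball x r)) ≤
      C * f r + (∑ k ∈ I, L.weight k) * (b * 3 ^ δ / a * r ^ δ) := by
  have ha := hB.a_pos
  have hb := hB.b_pos
  have hρ₀ (k : ℕ) : L.ρ k ≤ r₀ := by linarith [hS.ρ_le k, L.ρ_pos k]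
  rw [← Finset.sum_filter_add_sum_filter_not I fun k => r ≤ L.ρ k, Finset.sum_mul]
  refine add_le_add (hS.sum_cond_ball_le_of_le hC hf hr fun k hk =>
    (Finset.mem_filter.1 hk).2) ?_
  calc ∑ k ∈ I with ¬ r ≤ L.ρ k, ∑ c ∈ L.goodCentres S k,
        L.weight k * (L.ρ k ^ δ * m[|L.piece k c].real (Metric.ball x r))
      ≤ ∑ k ∈ I with ¬ r ≤ L.ρ k, L.weight k * (b * 3 ^ δ / a * r ^ δ) := by
        refine Finset.sum_le_sum fun k hk => ?_
        rw [← Finset.mul_sum]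
        exact mul_le_mul_of_nonneg_left (hS.sum_cond_ball_le_of_ge hB (hρ₀ k)
          (le_of_not_ge (Finset.mem_filter.1 hk).2)) (L.weight_nonneg k)
    _ ≤ ∑ k ∈ I, L.weight k * (b * 3 ^ δ / a * r ^ δ) :=
        Finset.sum_le_sum_of_subset_of_nonneg (Finset.filter_subset _ _) fun k _ _ =>
          mul_nonneg (L.weight_nonneg k) (by positivity)

end LevelSystem

namespace LevelSystem

section PseudoMetric

variable {Ω : Type*} [PseudoMetricSpace Ω] [MeasurableSpace Ω] {m : Measure Ω}
  {f : ℝ → ℝ} {δ p κ C a b r₀ : ℝ} {L : LevelSystem m f δ p κ C} {S : ℕ → Finset Ω} {x₀ : Ω}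
  {s c₃ : ℝ}

theorem exists_isPacking [CompactSpace Ω] [IsFiniteMeasure m] (L : LevelSystem m f δ p κ C)
    (hB : AhlforsBounds m δ a b r₀) (hκ : 0 < κ) (hsr₀ : s ≤ r₀) (hρ : ∀ k, L.ρ k ≤ s / 4)
    (hubiq : ∀ k, κ * m.real (Metric.ball x₀ (s / 2)) ≤
      m.real (Metric.ball x₀ (s / 2) ∩ ⋃ c ∈ L.centres k, Metric.ball c (L.ρ k))) :
    ∃ S, L.IsPacking x₀ s (κ * a / (b * 10 ^ δ)) S := by
  choose S hSmem hSsep hScard using fun k =>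
    hB.exists_packing hκ (L.ρ_pos k) hsr₀ (hρ k) (hubiq k)
  exact ⟨S, fun k c hc => (hSmem k c hc).1, fun k c hc => (hSmem k c hc).2, hSsep, hScard, hρ⟩

theorem not_summable_comp_add_left {L : LevelSystem m f δ p κ C} (hw : ¬ Summable L.weight)
    (N : ℕ) : ¬ Summable (L.comp (strictMono_id.const_add N)).weight := fun h =>
  hw ((summable_nat_add_iff N).1 (by
    have h' : Summable fun n => L.weight (N + n) := h
    simpa only [add_comm N] using h'))

/-- The mass distribution on the pieces around the good centres of the levels in `I`: each piece of
level `k` carries the mass `weight k * ρ k ^ δ`. -/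
noncomputable def blockMeasure (L : LevelSystem m f δ p κ C) (S : ℕ → Finset Ω) (I : Finset ℕ) :
    Measure Ω :=
  condMixture m (I.sigma (L.goodCentres S)) (fun q => L.weight q.1 * L.ρ q.1 ^ δ)
    fun q => L.piece q.1 q.2

theorem blockMeasure_apply (I : Finset ℕ) (B : Set Ω) :
    L.blockMeasure S I B = ENNReal.ofReal (∑ k ∈ I, ∑ c ∈ L.goodCentres S k,
      L.weight k * (L.ρ k ^ δ * m[|L.piece k c].real B)) := by
  rw [blockMeasure, condMixture_apply fun q _ => mul_nonneg (L.weight_nonneg _)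
    (Real.rpow_nonneg (L.ρ_pos _).le _), Finset.sum_sigma]
  simp only [mul_assoc]

instance (I : Finset ℕ) : IsFiniteMeasure (L.blockMeasure S I) := by
  unfold blockMeasure
  infer_instance

variable [IsFiniteMeasure m]

theorem IsPacking.le_blockMeasure_univ (hS : L.IsPacking x₀ s c₃ S) {I : Finset ℕ} {Q : ℝ}
    (hQ : ∀ k ∈ I, Q ≤ (L.goodCentres S k).card * L.ρ k ^ δ) :
    ENNReal.ofReal (Q * ∑ k ∈ I, L.weight k) ≤ L.blockMeasure S I univ := by
  rw [blockMeasure_apply]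
  refine ENNReal.ofReal_le_ofReal ?_
  rw [Finset.mul_sum]
  refine Finset.sum_le_sum fun k hk => ?_
  have hprob : ∀ c ∈ L.goodCentres S k, m[|L.piece k c].real univ = 1 := fun c hc =>
    have := cond_isProbabilityMeasure
      (L.isPiece k c (hS.mem k c (L.goodCentres_subset k hc))).measure_ne_zero
    probReal_univ
  calc Q * L.weight k ≤ ((L.goodCentres S k).card * L.ρ k ^ δ) * L.weight k :=
        mul_le_mul_of_nonneg_right (hQ k hk) (L.weight_nonneg k)
    _ = ∑ c ∈ L.goodCentres S k, L.weight k * (L.ρ k ^ δ * m[|L.piece k c].real univ) := by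
        rw [Finset.sum_congr rfl fun c hc => by rw [hprob c hc], Finset.sum_const, nsmul_eq_mul]
        ring

variable [OpensMeasurableSpace Ω]

theorem IsPacking.exists_boundedMeasure (hS : L.IsPacking x₀ s c₃ S) (hs : 0 < s) {I : Finset ℕ}
    {Q : ℝ} (hQ : 0 < Q) (hQI : ∀ k ∈ I, Q ≤ (L.goodCentres S k).card * L.ρ k ^ δ)
    (hI : 0 < ∑ k ∈ I, L.weight k) :
    ∃ ν : BoundedMeasure m, ν.carrier ⊆ Metric.ball x₀ s ∧
      (∃ τ > 0, Metric.thickening τ ν.carrier ⊆ ⋃ n, L.target n) ∧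
      ∀ B, ν.toMeasure B ≤ L.blockMeasure S I B / ENNReal.ofReal (Q * ∑ k ∈ I, L.weight k) := by
  have hmass := hS.le_blockMeasure_univ hQI
  have : NeZero (L.blockMeasure S I) := ⟨fun h => by
    rw [h, Measure.coe_zero, Pi.zero_apply, nonpos_iff_eq_zero, ENNReal.ofReal_eq_zero] at hmass
    exact hmass.not_gt (mul_pos hQ hI)⟩
  have hmem : ∀ q ∈ I.sigma (L.goodCentres S), q.2 ∈ S q.1 := fun q hq =>
    L.goodCentres_subset _ (Finset.mem_sigma.1 hq).2
  have hpiece : ∀ q ∈ I.sigma (L.goodCentres S), IsPiece m f δ p C (L.ρ q.1) (L.t q.1)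
      (L.weight q.1) q.2 (L.piece q.1 q.2) := fun q hq => L.isPiece _ _ (hS.mem _ _ (hmem q hq))
  obtain ⟨H, hH⟩ := exists_condMixture_le_smul (w := fun q => L.weight q.1 * L.ρ q.1 ^ δ)
    fun q hq => (hpiece q hq).measure_ne_zero
  obtain ⟨i, -, hi⟩ := I.exists_min_image L.t (Finset.nonempty_of_sum_ne_zero hI.ne')
  refine ⟨.ofMeasure (L.blockMeasure S I) (isOpen_biUnion fun q hq => (hpiece q hq).isOpen)
    (condMixture_compl_biUnion fun q hq => (hpiece q hq).isOpen.measurableSet) hH, ?_,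
    ⟨L.t i, L.t_pos i, ?_⟩, fun B => ?_⟩
  · refine iUnion₂_subset fun q hq =>
      (hpiece q hq).subset_ball.trans (Metric.ball_subset_ball' ?_)
    linarith [hS.dist_le _ _ (hmem q hq), hS.ρ_le q.1]
  · intro z hz
    obtain ⟨y, hy, hzy⟩ := Metric.mem_thickening_iff.1 hz
    obtain ⟨q, hq, hyq⟩ := mem_iUnion₂.1 hy
    exact mem_iUnion_of_mem q.1 (mem_iUnion₂_of_mem (hS.mem _ _ (hmem q hq))
      (Metric.mem_thickening_iff.2 ⟨y, hyq, hzy.trans_le (hi _ (Finset.mem_sigma.1 hq).1)⟩))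
  · rw [ENNReal.div_eq_inv_mul]
    exact mul_le_mul_left (ENNReal.inv_le_inv.2 hmass) _

theorem IsPacking.le_card_goodCentres_of_sum_lt (hS : L.IsPacking x₀ s c₃ S)
    (hB : AhlforsBounds m δ a b r₀) (hC : 0 ≤ C) (hf : ∀ r, 0 < r → 0 < f r) (hs : 0 < s)
    (hsr₀ : s ≤ r₀) {ζ : ℝ} (hL : L.IsLacunary ζ) (hζ : 0 < ζ) (hζC : 4 * C * b * ζ ≤ c₃ * a ^ 2)
    {K : ℝ} (hK : 0 < K) (hfs : ∀ r, 0 < r → r ≤ s → K / ζ * r ^ δ ≤ f r) {M : ℕ}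
    (hM : ∑ i ∈ Finset.range M, L.weight i < K) {k : ℕ} (hk : k ≤ M) :
    c₃ / 2 * s ^ δ ≤ (L.goodCentres S k).card * L.ρ k ^ δ := by
  refine hS.le_card_goodCentres hB hC hs hsr₀ hL ?_ hζC
  have hratio (i : ℕ) : (L.t i / L.ρ i) ^ p ≤ ζ / K * L.weight i := by
    have hti := L.t_pos i
    have hwi := L.weight_nonneg i
    have hfti := hf _ hti
    refine le_of_mul_le_mul_right ((L.ratio_le i).trans ?_) hfti
    calc L.weight i * L.t i ^ δ = ζ / K * L.weight i * (K / ζ * L.t i ^ δ) := by field_simp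
      _ ≤ ζ / K * L.weight i * f (L.t i) := by
          gcongr
          exact hfs _ hti (by linarith [L.t_le i, hS.ρ_le i])
  calc ∑ i ∈ Finset.range k, (L.t i / L.ρ i) ^ p ≤ ζ / K * ∑ i ∈ Finset.range k, L.weight i := by
        rw [Finset.mul_sum]
        exact Finset.sum_le_sum fun i _ => hratio i
    _ ≤ ζ / K * ∑ i ∈ Finset.range M, L.weight i := by
        gcongr ?_ * ?_
        exact Finset.sum_le_sum_of_subset_of_nonneg (Finset.range_mono hk)
          fun i _ _ => L.weight_nonneg i
    _ ≤ ζ / K * K := by gcongr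
    _ = ζ := div_mul_cancel₀ _ hK.ne'

/-- The levels are used up to the first one at which the weights add up to `4 C / (c₃ ε)`: this
makes the term `C f(r)` in `sum_cond_ball_le` small compared with the total mass. -/
theorem IsPacking.exists_boundedMeasure_ball_le (hS : L.IsPacking x₀ s c₃ S) (hc₃ : 0 < c₃)
    (hB : AhlforsBounds m δ a b r₀) (hC : 0 < C) (hf : ∀ r, 0 < r → 0 < f r) (hs : 0 < s)
    (hsr₀ : s ≤ r₀) {ζ : ℝ} (hL : L.IsLacunary ζ) (hζ : 0 < ζ) (hζC : 4 * C * b * ζ ≤ c₃ * a ^ 2)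
    (hw : ¬ Summable L.weight) {ε : ℝ} (hε : 0 < ε)
    (hfε : ∀ r, 0 < r → r ≤ s → 4 * (b * 3 ^ δ / a) / (c₃ * ε) * r ^ δ ≤ f r)
    (hfζ : ∀ r, 0 < r → r ≤ s → 4 * C / (c₃ * ε) / ζ * r ^ δ ≤ f r) :
    ∃ ν : BoundedMeasure m, ν.carrier ⊆ Metric.ball x₀ s ∧
      (∃ τ > 0, Metric.thickening τ ν.carrier ⊆ ⋃ n, L.target n) ∧
      ∀ x r, 0 < r → r ≤ s →
        ν.toMeasure (Metric.ball x r) ≤ ENNReal.ofReal (ε * s ^ (-δ) * f r) := by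
  set K := 4 * C / (c₃ * ε) with hKdef
  have hK : 0 < K := by positivity
  set C₃ := b * 3 ^ δ / a
  obtain ⟨M, hM, hM'⟩ := exists_sum_range_lt_le_sum_range_succ L.weight_nonneg hw hK
  set W := ∑ k ∈ Finset.range (M + 1), L.weight k
  have hW : 0 < W := hK.trans_le hM'
  set Q := c₃ / 2 * s ^ δ with hQdef
  have hQ : 0 < Q := by positivity
  obtain ⟨ν, hνs, hνE, hν⟩ := hS.exists_boundedMeasure hs hQ (fun k hk =>
    hS.le_card_goodCentres_of_sum_lt hB hC.le hf hs hsr₀ hL hζ hζC hK hfζ hM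
      (Nat.lt_succ_iff.1 (Finset.mem_range.1 hk))) hW
  refine ⟨ν, hνs, hνE, fun x r hr hrs => (hν _).trans ?_⟩
  have hfr := hf r hr
  rw [blockMeasure_apply, ← ENNReal.ofReal_div_of_pos (by positivity)]
  refine ENNReal.ofReal_le_ofReal ((div_le_iff₀ (by positivity)).2 ?_)
  refine (hS.sum_cond_ball_le hB hC.le hsr₀ hf _ hr).trans ?_
  have hterm₁ : C * f r ≤ W * (c₃ * ε / 4 * f r) := by
    calc C * f r = K * (c₃ * ε / 4 * f r) := by rw [hKdef]; field_simp
      _ ≤ W * (c₃ * ε / 4 * f r) := by gcongr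
  have hterm₂ : W * (C₃ * r ^ δ) ≤ W * (c₃ * ε / 4 * f r) := by
    calc W * (C₃ * r ^ δ) = W * (c₃ * ε / 4 * (4 * C₃ / (c₃ * ε) * r ^ δ)) := by field_simp
      _ ≤ W * (c₃ * ε / 4 * f r) := by
          gcongr
          exact hfε r hr hrs
  calc C * f r + W * (C₃ * r ^ δ) ≤ W * (c₃ * ε / 4 * f r) + W * (c₃ * ε / 4 * f r) :=
        add_le_add hterm₁ hterm₂
    _ = ε * s ^ (-δ) * f r * (Q * W) := by
        rw [Real.rpow_neg hs.le, hQdef]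
        field_simp
        ring

theorem isFrostmanRich_iUnion_target [CompactSpace Ω] (hB : AhlforsBounds m δ a b r₀) (hκ : 0 < κ)
    (hC : 0 < C) (hf : ∀ r, 0 < r → 0 < f r)
    (hfδ : Tendsto (fun r : ℝ => r ^ (-δ) * f r) (𝓝[>] 0) atTop) {ζ : ℝ} (hL : L.IsLacunary ζ)
    (hζ : 0 < ζ) (hζC : 4 * C * b * ζ ≤ κ * a / (b * 10 ^ δ) * a ^ 2)
    (hw : ¬ Summable L.weight) : IsFrostmanRich m f δ (⋃ n, L.target n) := by
  intro ε hε
  have ha := hB.a_pos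
  have hb := hB.b_pos
  have hr₀ := hB.r₀_pos
  set c₃ := κ * a / (b * 10 ^ δ)
  have hc₃ : 0 < c₃ := by positivity
  obtain ⟨r₁, hr₁, hubiq⟩ := L.ubiquitous
  obtain ⟨s₁, hs₁, hfs₁⟩ := exists_forall_mul_rpow_le hfδ (4 * (b * 3 ^ δ / a) / (c₃ * ε))
  obtain ⟨s₂, hs₂, hfs₂⟩ := exists_forall_mul_rpow_le hfδ (4 * C / (c₃ * ε) / ζ)
  refine ⟨min (min s₁ s₂) (min r₀ r₁), by positivity, fun s hs hss x₀ => ?_⟩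
  simp only [le_min_iff] at hss
  obtain ⟨⟨hss₁, hss₂⟩, hsr₀, hsr₁⟩ := hss
  obtain ⟨N, hN⟩ := eventually_atTop.1 ((L.ρ_lim.eventually_le_const
    (show (0 : ℝ) < s / 4 by positivity)).and (hubiq x₀ (s / 2) (by positivity) (by linarith)))
  set L' := L.comp (strictMono_id.const_add N)
  obtain ⟨S, hS⟩ := L'.exists_isPacking hB hκ hsr₀ (x₀ := x₀)
    (fun k => (hN (N + k) (Nat.le_add_right N k)).1) fun k => (hN (N + k) (Nat.le_add_right N k)).2
  obtain ⟨ν, hνs, ⟨τ, hτ, hντ⟩, hν⟩ := hS.exists_boundedMeasure_ball_le hc₃ hB hC hf hs hsr₀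
    (hL.comp_add_left N) hζ hζC (not_summable_comp_add_left hw N) hε
    (fun r hr hrs => hfs₁ r hr (hrs.trans hss₁)) fun r hr hrs => hfs₂ r hr (hrs.trans hss₂)
  exact ⟨ν, hνs, ⟨τ, hτ, hντ.trans (iUnion_subset fun n => subset_iUnion L.target (N + n))⟩, hν⟩

end PseudoMetric

section Metric

variable {Ω : Type*} [MetricSpace Ω] [MeasurableSpace Ω] {m : Measure Ω} {f : ℝ → ℝ}
  {δ p κ C a b r₀ : ℝ} {L : LevelSystem m f δ p κ C}

theorem exists_comp_isLacunary (hp : 0 < p) (hdiv : DivergesLacunarily L.ρ L.weight) {ζ : ℝ}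
    (hζ : 0 < ζ) : ∃ (φ : ℕ → ℕ) (hφ : StrictMono φ),
      (L.comp hφ).IsLacunary ζ ∧ ¬ Summable (L.comp hφ).weight := by
  obtain ⟨θ, hθ, hθ8, hsum⟩ := exists_lacunary_sum_rpow_le hp hζ
  obtain ⟨φ, hφ, hlac, hw⟩ := hdiv θ hθ
  have hρ (n : ℕ) : 0 < (L.comp hφ).ρ n := (L.comp hφ).ρ_pos n
  refine ⟨φ, hφ, ⟨fun n => (hlac n).trans ?_, hsum _ hρ hlac⟩, hw⟩
  calc θ * L.ρ (φ n) ≤ 1 / 8 * L.ρ (φ n) := mul_le_mul_of_nonneg_right hθ8 (hρ n).le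
    _ = L.ρ (φ n) / 8 := one_div_mul_eq_div _ _

theorem hausdorffMeasureFun_eq_top [CompactSpace Ω] [OpensMeasurableSpace Ω] [IsFiniteMeasure m]
    [NeZero m] (hB : AhlforsBounds m δ a b r₀) (hp : 0 < p) (hκ : 0 < κ) (hC : 0 < C)
    (hf : ∀ r, 0 < r → 0 < f r)
    (hfδ : Tendsto (fun r : ℝ => r ^ (-δ) * f r) (𝓝[>] 0) atTop)
    (hfδ_anti : AntitoneOn (fun r : ℝ => r ^ (-δ) * f r) (Ioi 0))
    (hdiv : DivergesLacunarily L.ρ L.weight) :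
    hausdorffMeasureFun f {x | ∃ᶠ n in atTop, x ∈ L.target n} = ⊤ := by
  have ha := hB.a_pos
  have hb := hB.b_pos
  obtain ⟨ζ, hζ, hζC⟩ : ∃ ζ > 0, 4 * C * b * ζ ≤ κ * a / (b * 10 ^ δ) * a ^ 2 :=
    ⟨κ * a / (b * 10 ^ δ) * a ^ 2 / (4 * C * b), by positivity,
      (mul_div_cancel₀ _ (by positivity)).le⟩
  obtain ⟨φ, hφ, hL, hw⟩ := L.exists_comp_isLacunary hp hdiv hζ
  have hrich (N : ℕ) : IsFrostmanRich m f δ (⋃ n, L.target (φ (N + n))) :=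
    (L.comp hφ |>.comp (strictMono_id.const_add N)).isFrostmanRich_iUnion_target hB hκ hC hf hfδ
      (hL.comp_add_left N) hζ hζC (not_summable_comp_add_left hw N)
  refine top_le_iff.1 ((hausdorffMeasureFun_iInter_eq_top hB hf hfδ hfδ_anti hrich).ge.trans
    (hausdorffMeasureFun_mono f fun x hx => frequently_atTop.2 fun N => ?_))
  obtain ⟨n, hn⟩ := mem_iUnion.1 (mem_iInter.1 hx N)
  exact ⟨φ (N + n), (Nat.le_add_right N n).trans hφ.le_apply, hn⟩

end Metric

end LevelSystem

section LevelWeight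

/-- The weight `f(t) t ^ (-γ) ρ ^ (γ - δ)` of the `t`-neighbourhood of a resonant set, seen from the
scale `ρ`. For `t = ψ(r)` and `ρ = ρ(r)` this is `g(r)`. -/
noncomputable def levelWeight (f : ℝ → ℝ) (γ δ t ρ : ℝ) : ℝ :=
  f t * t ^ (-γ) * ρ ^ (γ - δ)

variable {f : ℝ → ℝ} {γ δ t ρ : ℝ}

theorem levelWeight_pos (hf : ∀ r, 0 < r → 0 < f r) (ht : 0 < t) (hρ : 0 < ρ) :
    0 < levelWeight f γ δ t ρ := by
  have hft := hf t ht
  unfold levelWeight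
  positivity

theorem levelWeight_mul_rpow (ht : 0 < t) (hρ : 0 < ρ) :
    levelWeight f γ δ t ρ * ρ ^ δ = f t * (ρ / t) ^ γ := by
  rw [levelWeight, mul_assoc _ (ρ ^ (γ - δ)), ← Real.rpow_add hρ, sub_add_cancel,
    Real.rpow_neg ht.le, Real.div_rpow hρ.le ht.le]
  ring

theorem div_rpow_mul_eq_levelWeight_mul_rpow (ht : 0 < t) (hρ : 0 < ρ) :
    (t / ρ) ^ (δ - γ) * f t = levelWeight f γ δ t ρ * t ^ δ := by
  rw [levelWeight, ← neg_sub δ γ, Real.rpow_neg hρ.le, Real.rpow_neg ht.le,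
    Real.div_rpow ht.le hρ.le, Real.rpow_sub ht]
  ring

theorem mul_levelWeight_le_levelWeight_half (hρ : 0 < ρ) (ht : 0 < t)
    (hfδ_anti : AntitoneOn (fun r : ℝ => r ^ (-δ) * f r) (Ioi 0)) :
    2 ^ (γ - δ) * levelWeight f γ δ t ρ ≤ levelWeight f γ δ (t / 2) ρ := by
  have hanti := hfδ_anti (mem_Ioi.2 (half_pos ht)) (mem_Ioi.2 ht) (half_le_self ht.le)
  calc 2 ^ (γ - δ) * levelWeight f γ δ t ρ
      = t ^ (-δ) * f t * ((t / 2) ^ (δ - γ) * ρ ^ (γ - δ)) := by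
        rw [levelWeight, ← neg_sub δ γ, Real.div_rpow ht.le zero_le_two, Real.rpow_neg zero_le_two,
          Real.rpow_neg ht.le, Real.rpow_neg ht.le, Real.rpow_sub ht]
        field_simp
    _ ≤ (t / 2) ^ (-δ) * f (t / 2) * ((t / 2) ^ (δ - γ) * ρ ^ (γ - δ)) :=
        mul_le_mul_of_nonneg_right hanti (by positivity)
    _ = levelWeight f γ δ (t / 2) ρ := by
        rw [levelWeight, ← neg_add_eq_sub γ δ, Real.rpow_add (half_pos ht),
          Real.rpow_neg (half_pos ht).le δ]
        field_simp

theorem levelWeight_self (hρ : 0 < ρ) : levelWeight f γ δ ρ ρ = ρ ^ (-δ) * f ρ := by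
  rw [levelWeight, mul_assoc, ← Real.rpow_add hρ, mul_comm]
  ring_nf

theorem min_levelWeight_le (hρ : 0 < ρ) (hρf : 1 ≤ ρ ^ (-δ) * f ρ) (t : ℝ) :
    min (levelWeight f γ δ t ρ) 1 ≤ levelWeight f γ δ (min t ρ) ρ := by
  rcases min_choice t ρ with h | h <;> rw [h]
  · exact min_le_left _ _
  · exact (min_le_right _ _).trans (hρf.trans_eq (levelWeight_self hρ).symm)

theorem mul_min_levelWeight_le (hρ : 0 < ρ) (ht : 0 < t)
    (hfδ_anti : AntitoneOn (fun r : ℝ => r ^ (-δ) * f r) (Ioi 0)) (hρf : 1 ≤ ρ ^ (-δ) * f ρ) :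
    2 ^ (γ - δ) * min (levelWeight f γ δ t ρ) 1 ≤ levelWeight f γ δ (min t ρ / 2) ρ :=
  calc 2 ^ (γ - δ) * min (levelWeight f γ δ t ρ) 1
      ≤ 2 ^ (γ - δ) * levelWeight f γ δ (min t ρ) ρ := by
        gcongr
        exact min_levelWeight_le hρ hρf t
    _ ≤ levelWeight f γ δ (min t ρ / 2) ρ :=
        mul_levelWeight_le_levelWeight_half hρ (lt_min ht hρ) hfδ_anti

end LevelWeight

/-- The intersection conditions with dimension `γ` for a single set `A` at the scale `ρ`. The
measures of the balls `B(c, t)` are replaced by `t ^ δ`. -/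
structure HasIntersectionBounds {Ω : Type*} [PseudoMetricSpace Ω] [MeasurableSpace Ω]
    (m : Measure Ω) (δ γ c₁ c₂ ρ : ℝ) (A : Set Ω) : Prop where
  lower : ∀ c ∈ A, ∀ t, 0 < t → t ≤ ρ →
    c₁ * t ^ δ * (ρ / t) ^ γ ≤ m.real (Metric.ball c (ρ / 2) ∩ Metric.thickening t A)
  upper : ∀ c ∈ A, ∀ t, 0 < t → t ≤ ρ → ∀ y ∈ A, ∀ s, 0 < s → s ≤ 3 * ρ →
    m.real (Metric.ball y s ∩ Metric.ball c (3 * ρ) ∩ Metric.thickening (3 * t) A) ≤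
      c₂ * t ^ δ * (s / t) ^ γ

theorem IntersectionConditions.exists_hasIntersectionBounds {Ω J : Type*} [MetricSpace Ω]
    [MeasurableSpace Ω] {m : Measure Ω} [IsFiniteMeasure m] {R : J → Set Ω} {β : J → ℝ}
    {ρ : ℝ → ℝ} {u : ℕ → ℝ} {γ δ a b r₀ : ℝ} (h : IntersectionConditions m R β ρ u γ)
    (hB : AhlforsBounds m δ a b r₀) (hρ : Tendsto (fun n => ρ (u n)) atTop (𝓝 0)) :
    ∃ c₁ > 0, ∃ c₂ > 0, ∀ᶠ n in atTop, ∀ α, β α ≤ u n →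
      HasIntersectionBounds m δ γ c₁ c₂ (ρ (u n)) (R α) := by
  obtain ⟨-, -, c₁, c₂, hc₁, hc₂, h⟩ := h
  have ha := hB.a_pos
  have hb := hB.b_pos
  refine ⟨c₁ * a, by positivity, c₂ * b, by positivity, ?_⟩
  filter_upwards [h, hρ.eventually_le_const hB.r₀_pos] with n hn hρn α hα
  refine ⟨fun c hc t ht htρ => ?_, fun c hc t ht htρ y hy s hs hsρ => ?_⟩
  · have hpos : 0 < (ρ (u n) / t) ^ γ := Real.rpow_pos_of_pos (div_pos (ht.trans_le htρ) ht) _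
    have hlower := (hn α hα c hc t ht htρ).1
    rw [← ofReal_measureReal (μ := m) (s := Metric.ball c t), ← ENNReal.ofReal_mul hc₁.le,
      ← ENNReal.ofReal_mul (by positivity),
      ENNReal.ofReal_le_iff_le_toReal (measure_ne_top _ _)] at hlower
    refine le_trans ?_ hlower
    rw [mul_assoc c₁]
    gcongr
    exact hB.lower c t ht (htρ.trans hρn)
  · have hupper := (hn α hα c hc t ht htρ).2 y (mem_iUnion_of_mem α hy) s hs hsρ
    rw [← ofReal_measureReal (μ := m) (s := Metric.ball c t), ← ENNReal.ofReal_mul hc₂.le,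
      ← ENNReal.ofReal_mul (by positivity)] at hupper
    refine (ENNReal.toReal_le_of_le_ofReal (by positivity) hupper).trans ?_
    rw [mul_assoc c₂ b]
    gcongr
    exact hB.upper c t ht

/-- The part of the `t`-neighbourhood of `A` near `c` which is the piece of a level of scale `ρ`. -/
def localPart {Ω : Type*} [PseudoMetricSpace Ω] (A : Set Ω) (ρ t : ℝ) (c : Ω) : Set Ω :=
  Metric.ball c (ρ / 2) ∩ Metric.thickening t A

theorem thickening_localPart_subset {Ω : Type*} [PseudoMetricSpace Ω] (A : Set Ω) (ρ t w : ℝ)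
    (c : Ω) : Metric.thickening w (localPart A ρ t c) ⊆
      Metric.ball c (ρ / 2 + w) ∩ Metric.thickening (t + w) A := by
  intro z hz
  obtain ⟨y, ⟨hyc, hyA⟩, hzy⟩ := Metric.mem_thickening_iff.1 hz
  obtain ⟨v, hv, hyv⟩ := Metric.mem_thickening_iff.1 hyA
  rw [Metric.mem_ball] at hyc
  exact ⟨Metric.mem_ball.2 (by linarith [dist_triangle z y c]),
    Metric.mem_thickening_iff.2 ⟨v, hv, by linarith [dist_triangle z y v]⟩⟩

namespace HasIntersectionBounds

variable {Ω : Type*} [PseudoMetricSpace Ω] [MeasurableSpace Ω] {m : Measure Ω} {A : Set Ω}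
  {δ γ c₁ c₂ ρ a b r₀ t : ℝ} {c : Ω} {f : ℝ → ℝ}

theorem measureReal_localPart_pos (h : HasIntersectionBounds m δ γ c₁ c₂ ρ A) (hc₁ : 0 < c₁)
    (hc : c ∈ A) (ht : 0 < t) (htρ : t ≤ ρ) : 0 < m.real (localPart A ρ t c) := by
  have hρ : 0 < ρ := ht.trans_le htρ
  exact (h.lower c hc t ht htρ).trans_lt' (by positivity)

variable [IsFiniteMeasure m]

theorem measureReal_ball_inter_localPart_le (h : HasIntersectionBounds m δ γ c₁ c₂ ρ A)
    (hc₂ : 0 < c₂) (hc : c ∈ A) (ht : 0 < t) (htρ : t ≤ ρ) (x : Ω) {r : ℝ} (htr : t ≤ r)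
    (hrρ : r ≤ ρ) :
    m.real (Metric.ball x r ∩ localPart A ρ t c) ≤ c₂ * t ^ δ * (3 * r / t) ^ γ := by
  have hr : 0 < r := ht.trans_le htr
  rcases eq_empty_or_nonempty (Metric.ball x r ∩ localPart A ρ t c) with hempty | ⟨z, hz, -, hzA⟩
  · rw [hempty, measureReal_empty]
    positivity
  obtain ⟨y, hy, hzy⟩ := Metric.mem_thickening_iff.1 hzA
  refine (measureReal_mono ?_ (measure_ne_top _ _)).trans
    (h.upper c hc t ht htρ y hy (3 * r) (by positivity) (by linarith))
  rintro v ⟨hv, hvc, hvA⟩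
  rw [Metric.mem_ball] at hv
  rw [Metric.mem_ball'] at hz
  exact ⟨⟨Metric.mem_ball.2 (by linarith [dist_triangle4 v x z y]),
    Metric.ball_subset_ball (by linarith) hvc⟩, Metric.thickening_mono (by linarith) _ hvA⟩

/-- Up to the scale `t`, the piece looks like the ambient space of dimension `δ`, and from there to
the scale `ρ` like a set of dimension `γ`. -/
theorem measureReal_ball_inter_localPart_mul_le (h : HasIntersectionBounds m δ γ c₁ c₂ ρ A)
    (hB : AhlforsBounds m δ a b r₀) (hc₂ : 0 < c₂) (hf : ∀ r, 0 < r → 0 < f r)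
    (hfδ_anti : AntitoneOn (fun r : ℝ => r ^ (-δ) * f r) (Ioi 0))
    (hfγ_mono : MonotoneOn (fun r : ℝ => r ^ (-γ) * f r) (Ioi 0)) (hc : c ∈ A) (ht : 0 < t)
    (htρ : t ≤ ρ) (x : Ω) {r : ℝ} (hr : 0 < r) (hrρ : r ≤ ρ) :
    m.real (Metric.ball x r ∩ localPart A ρ t c) * f t ≤ (b + c₂ * 3 ^ γ) * (t ^ δ * f r) := by
  have hb := hB.b_pos
  have hft := hf t ht
  have hfr := hf r hr
  rcases le_total r t with hrt | htr
  · have hanti := (rpow_neg_mul_le_rpow_neg_mul_iff ht hr ..).1 (hfδ_anti hr ht hrt)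
    calc m.real (Metric.ball x r ∩ localPart A ρ t c) * f t ≤ b * r ^ δ * f t := by
          gcongr
          exact (measureReal_mono inter_subset_left).trans (hB.upper x r hr)
      _ ≤ b * (t ^ δ * f r) := by
          rw [mul_assoc]
          gcongr
      _ ≤ (b + c₂ * 3 ^ γ) * (t ^ δ * f r) := by
          gcongr
          exact le_add_of_nonneg_right (by positivity)
  · have hmono := (rpow_neg_mul_le_rpow_neg_mul_iff ht hr ..).1 (hfγ_mono ht hr htr)
    have htγ : 0 < t ^ γ := by positivity
    calc m.real (Metric.ball x r ∩ localPart A ρ t c) * f t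
        ≤ c₂ * t ^ δ * (3 * r / t) ^ γ * f t := by
          gcongr
          exact h.measureReal_ball_inter_localPart_le hc₂ hc ht htρ x htr hrρ
      _ = c₂ * 3 ^ γ * t ^ δ * (r ^ γ * f t / t ^ γ) := by
          rw [Real.div_rpow (by positivity) ht.le, Real.mul_rpow (by norm_num) hr.le]
          ring
      _ ≤ c₂ * 3 ^ γ * t ^ δ * f r := by
          gcongr
          exact (div_le_iff₀' htγ).2 hmono
      _ ≤ (b + c₂ * 3 ^ γ) * (t ^ δ * f r) := by
          rw [mul_assoc _ (t ^ δ)]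
          gcongr
          exact le_add_of_nonneg_left hb.le

theorem cond_localPart_ball_le [OpensMeasurableSpace Ω] (h : HasIntersectionBounds m δ γ c₁ c₂ ρ A)
    (hB : AhlforsBounds m δ a b r₀) (hc₁ : 0 < c₁) (hc₂ : 0 < c₂) (hf : ∀ r, 0 < r → 0 < f r)
    (hfδ_anti : AntitoneOn (fun r : ℝ => r ^ (-δ) * f r) (Ioi 0))
    (hfγ_mono : MonotoneOn (fun r : ℝ => r ^ (-γ) * f r) (Ioi 0)) (hc : c ∈ A) (ht : 0 < t)
    (htρ : t ≤ ρ) (x : Ω) {r : ℝ} (hr : 0 < r) (hrρ : r ≤ ρ) :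
    levelWeight f γ δ t ρ * (ρ ^ δ * m[|localPart A ρ t c].real (Metric.ball x r)) ≤
      (b + c₂ * 3 ^ γ) / c₁ * f r := by
  have hρ : 0 < ρ := ht.trans_le htρ
  have hb := hB.b_pos
  have hfr := hf r hr
  have hmeas : MeasurableSet (localPart A ρ t c) :=
    (Metric.isOpen_ball.inter Metric.isOpen_thickening).measurableSet
  have hpos := h.measureReal_localPart_pos hc₁ hc ht htρ
  have hcond : m[|localPart A ρ t c].real (Metric.ball x r) = (m.real (localPart A ρ t c))⁻¹ *
      m.real (Metric.ball x r ∩ localPart A ρ t c) := by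
    simp only [measureReal_def, cond_apply hmeas, ENNReal.toReal_mul, ENNReal.toReal_inv,
      inter_comm]
  rw [← mul_assoc, levelWeight_mul_rpow ht hρ, hcond]
  calc f t * (ρ / t) ^ γ * ((m.real (localPart A ρ t c))⁻¹ *
        m.real (Metric.ball x r ∩ localPart A ρ t c))
      = m.real (Metric.ball x r ∩ localPart A ρ t c) * f t * (ρ / t) ^ γ /
          m.real (localPart A ρ t c) := by ring
    _ ≤ (b + c₂ * 3 ^ γ) * (t ^ δ * f r) * (ρ / t) ^ γ / m.real (localPart A ρ t c) := by
        gcongr ?_ * _ / _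
        exact h.measureReal_ball_inter_localPart_mul_le hB hc₂ hf hfδ_anti hfγ_mono hc ht htρ x hr
          hrρ
    _ = (b + c₂ * 3 ^ γ) / c₁ * f r * (c₁ * t ^ δ * (ρ / t) ^ γ) / m.real (localPart A ρ t c) := by
        field_simp
    _ ≤ (b + c₂ * 3 ^ γ) / c₁ * f r := by
        rw [div_le_iff₀ hpos]
        gcongr
        exact h.lower c hc t ht htρ

theorem measureReal_thickening_localPart_le (h : HasIntersectionBounds m δ γ c₁ c₂ ρ A)
    (hc₂ : 0 < c₂) (hγδ : γ < δ) (hc : c ∈ A) (ht : 0 < t) (htρ : t ≤ ρ / 2) {w : ℝ} (hw : 0 < w)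
    (hwρ : w ≤ ρ / 2) :
    m.real (Metric.thickening w (localPart A ρ t c)) ≤
      c₂ * 3 ^ γ * 2 ^ (δ - γ) * ρ ^ δ * ((t / ρ) ^ (δ - γ) + (w / ρ) ^ (δ - γ)) := by
  have hρ : 0 < ρ := by linarith
  have hp : 0 < δ - γ := sub_pos.2 hγδ
  have htw : 0 < t + w := add_pos ht hw
  have hsub : Metric.thickening w (localPart A ρ t c) ⊆
      Metric.ball c (3 * ρ) ∩ Metric.ball c (3 * ρ) ∩ Metric.thickening (3 * (t + w)) A := by
    rw [inter_self]
    exact (thickening_localPart_subset A ρ t w c).trans (inter_subset_inter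
      (Metric.ball_subset_ball (by linarith)) (Metric.thickening_mono (by linarith) A))
  have hmax : t + w ≤ 2 * max t w := by linarith [le_max_left t w, le_max_right t w]
  calc m.real (Metric.thickening w (localPart A ρ t c))
      ≤ c₂ * (t + w) ^ δ * (3 * ρ / (t + w)) ^ γ :=
        (measureReal_mono hsub (measure_ne_top _ _)).trans
          (h.upper c hc (t + w) htw (by linarith) c hc (3 * ρ) (by positivity) le_rfl)
    _ = c₂ * 3 ^ γ * ρ ^ δ * ((t + w) / ρ) ^ (δ - γ) := by
        rw [Real.div_rpow (by positivity) htw.le, Real.mul_rpow (by norm_num) hρ.le,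
          Real.div_rpow htw.le hρ.le, Real.rpow_sub htw, Real.rpow_sub hρ]
        field_simp
    _ ≤ c₂ * 3 ^ γ * ρ ^ δ * (2 * max t w / ρ) ^ (δ - γ) := by gcongr
    _ = c₂ * 3 ^ γ * 2 ^ (δ - γ) * ρ ^ δ * max ((t / ρ) ^ (δ - γ)) ((w / ρ) ^ (δ - γ)) := by
        rw [mul_div_assoc, Real.mul_rpow zero_le_two (by positivity),
          ← max_div_div_right hρ.le, (Real.monotoneOn_rpow_Ici_of_exponent_nonneg hp.le).map_max
            (mem_Ici.2 (by positivity)) (mem_Ici.2 (by positivity))]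
        ring
    _ ≤ c₂ * 3 ^ γ * 2 ^ (δ - γ) * ρ ^ δ * ((t / ρ) ^ (δ - γ) + (w / ρ) ^ (δ - γ)) := by
        gcongr
        exact max_le_add_of_nonneg (by positivity) (by positivity)

theorem isPiece_localPart [OpensMeasurableSpace Ω] (h : HasIntersectionBounds m δ γ c₁ c₂ ρ A)
    (hB : AhlforsBounds m δ a b r₀) (hc₁ : 0 < c₁) (hc₂ : 0 < c₂) (hγδ : γ < δ)
    (hf : ∀ r, 0 < r → 0 < f r)
    (hfδ_anti : AntitoneOn (fun r : ℝ => r ^ (-δ) * f r) (Ioi 0))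
    (hfγ_mono : MonotoneOn (fun r : ℝ => r ^ (-γ) * f r) (Ioi 0)) (hc : c ∈ A) (ht : 0 < t)
    (htρ : t ≤ ρ / 2) {C : ℝ} (hC₁ : (b + c₂ * 3 ^ γ) / c₁ ≤ C)
    (hC₂ : c₂ * 3 ^ γ * 2 ^ (δ - γ) ≤ C) :
    IsPiece m f δ (δ - γ) C ρ t (levelWeight f γ δ t ρ) c (localPart A ρ t c) := by
  have hρ : 0 < ρ := by linarith
  have htρ' : t ≤ ρ := by linarith
  refine ⟨Metric.isOpen_ball.inter Metric.isOpen_thickening, inter_subset_left, fun h0 => ?_,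
    fun x r hr hrρ => ?_, fun w hw hwρ => ?_⟩
  · exact (h.measureReal_localPart_pos hc₁ hc ht htρ').ne' (by rw [measureReal_def, h0]; rfl)
  · exact (h.cond_localPart_ball_le hB hc₁ hc₂ hf hfδ_anti hfγ_mono hc ht htρ' x hr hrρ).trans
      (mul_le_mul_of_nonneg_right hC₁ (hf r hr).le)
  · refine (h.measureReal_thickening_localPart_le hc₂ hγδ hc ht htρ hw hwρ).trans ?_
    gcongr

end HasIntersectionBounds

theorem exists_levelSystem {Ω J : Type*} [PseudoMetricSpace Ω] [MeasurableSpace Ω]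
    [OpensMeasurableSpace Ω] {m : Measure Ω} [IsFiniteMeasure m] {R : J → Set Ω}
    {δ γ c₁ c₂ κ a b r₀ : ℝ} {f : ℝ → ℝ} {ρ t : ℕ → ℝ} {I : ℕ → Set J}
    (hB : AhlforsBounds m δ a b r₀) (hf : ∀ r, 0 < r → 0 < f r)
    (hfδ_anti : AntitoneOn (fun r : ℝ => r ^ (-δ) * f r) (Ioi 0))
    (hfγ_mono : MonotoneOn (fun r : ℝ => r ^ (-γ) * f r) (Ioi 0)) (hγδ : γ < δ)
    (hρ : ∀ n, 0 < ρ n) (hρ0 : Tendsto ρ atTop (𝓝 0)) (ht : ∀ n, 0 < t n)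
    (htρ : ∀ n, t n ≤ ρ n / 2) (hc₁ : 0 < c₁) (hc₂ : 0 < c₂)
    (hint : ∀ n, ∀ α ∈ I n, HasIntersectionBounds m δ γ c₁ c₂ (ρ n) (R α))
    (hubiq : ∃ r₁ > 0, ∀ x r, 0 < r → r ≤ r₁ → ∀ᶠ n in atTop, κ * m.real (Metric.ball x r) ≤
      m.real (Metric.ball x r ∩ ⋃ α ∈ I n, Metric.thickening (ρ n) (R α))) :
    ∃ C > 0, ∃ L : LevelSystem m f δ (δ - γ) κ C, L.ρ = ρ ∧
      (L.weight = fun n => levelWeight f γ δ (t n) (ρ n)) ∧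
      ∀ n, L.target n ⊆ ⋃ α ∈ I n, Metric.thickening (2 * t n) (R α) := by
  have hb := hB.b_pos
  set C := max ((b + c₂ * 3 ^ γ) / c₁) (c₂ * 3 ^ γ * 2 ^ (δ - γ))
  have hpiece (n : ℕ) (c : Ω) : ∃ T : Set Ω, c ∈ ⋃ α ∈ I n, R α →
      IsPiece m f δ (δ - γ) C (ρ n) (t n) (levelWeight f γ δ (t n) (ρ n)) c T ∧
        Metric.thickening (t n) T ⊆ ⋃ α ∈ I n, Metric.thickening (2 * t n) (R α) := by
    by_cases h : c ∈ ⋃ α ∈ I n, R α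
    · obtain ⟨α, hα, hc⟩ := mem_iUnion₂.1 h
      refine ⟨localPart (R α) (ρ n) (t n) c, fun _ => ⟨(hint n α hα).isPiece_localPart hB hc₁ hc₂
        hγδ hf hfδ_anti hfγ_mono hc (ht n) (htρ n) (le_max_left _ _) (le_max_right _ _), ?_⟩⟩
      rw [two_mul]
      exact (thickening_localPart_subset _ _ _ _ c).trans
        (inter_subset_right.trans (subset_iUnion₂_of_subset α hα subset_rfl))
    · exact ⟨∅, fun h' => absurd h' h⟩
  choose T hT hTsub using hpiece
  let L : LevelSystem m f δ (δ - γ) κ C :=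
    { ρ := ρ
      t := t
      weight := fun n => levelWeight f γ δ (t n) (ρ n)
      centres := fun n => ⋃ α ∈ I n, R α
      piece := T
      ρ_pos := hρ
      ρ_lim := hρ0
      t_pos := ht
      t_le := fun n => (htρ n).trans (half_le_self (hρ n).le)
      weight_nonneg := fun n => (levelWeight_pos hf (ht n) (hρ n)).le
      ratio_le := fun n => (div_rpow_mul_eq_levelWeight_mul_rpow (ht n) (hρ n)).le
      isPiece := hT
      ubiquitous := by
        simpa only [biUnion_iUnion, Metric.thickening_eq_biUnion_ball] using hubiq }
  exact ⟨C, lt_max_of_lt_left (by positivity), L, rfl, rfl,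
    fun n => iUnion₂_subset fun c hc => hTsub n c hc⟩

theorem frequently_subset_limsupSet {Ω J : Type*} [MetricSpace Ω] {R : J → Set Ω} {β : J → ℝ}
    (hβ : ∀ α, 0 < β α) {l u : ℕ → ℝ} (hl : Tendsto l atTop atTop) {ψ : ℝ → ℝ}
    (hψ : AntitoneOn ψ (Ioi 0)) {t : ℕ → ℝ} (ht : ∀ n, t n ≤ ψ (u n)) :
    {x | ∃ᶠ n in atTop, x ∈ ⋃ α ∈ {α | l n < β α ∧ β α ≤ u n}, Metric.thickening (t n) (R α)} ⊆
      limsupSet R β ψ := by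
  intro x hx hfin
  obtain ⟨B, hB⟩ := (hfin.image β).bddAbove
  obtain ⟨n, hn, hln⟩ := (Frequently.and_eventually hx (hl.eventually_ge_atTop B)).exists
  obtain ⟨α, ⟨hlα, hαu⟩, hxα⟩ := mem_iUnion₂.1 hn
  have htψ : t n ≤ ψ (β α) := (ht n).trans (hψ (hβ α) ((hβ α).trans_le hαu) hαu)
  have hβB : β α ≤ B := hB (mem_image_of_mem β (Metric.thickening_mono htψ _ hxα))
  exact hlα.not_ge (hβB.trans hln)

section LimsupSet

variable {Ω J : Type*} [MetricSpace Ω] [MeasurableSpace Ω] {m : Measure Ω} [IsFiniteMeasure m]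
  {R : J → Set Ω} {β : J → ℝ} {l u : ℕ → ℝ} {ρ ψ f : ℝ → ℝ} {γ δ a b r₀ : ℝ}

theorem eventually_mul_measureReal_le_unionNhd {κ : ℝ} (hκ : 0 < κ) {x : Ω} {r : ℝ}
    (h : ∀ᶠ n in atTop, ENNReal.ofReal κ * m (Metric.ball x r) ≤
      m (Metric.ball x r ∩ unionNhd R β ρ l u n)) :
    ∀ᶠ n in atTop, κ * m.real (Metric.ball x r) ≤
      m.real (Metric.ball x r ∩ unionNhd R β ρ l u n) := by
  filter_upwards [h] with n hn
  rwa [← ofReal_measureReal (μ := m) (s := Metric.ball x r), ← ENNReal.ofReal_mul hκ.le,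
    ENNReal.ofReal_le_iff_le_toReal (measure_ne_top _ _)] at hn

variable [OpensMeasurableSpace Ω]

theorem LocallyUbiquitous.exists_levelSystem (hub : LocallyUbiquitous m R β ρ l u γ)
    (hB : AhlforsBounds m δ a b r₀) (hβ : ∀ α, 0 < β α) (hu : ∀ n, 0 < u n)
    (hlu : ∀ n, l n < u n) (hl : Tendsto l atTop atTop) (hρ : IsUbiquityFunction ρ)
    (hψ : IsApproximating ψ) (hf : ∀ r, 0 < r → 0 < f r)
    (hfδ : Tendsto (fun r : ℝ => r ^ (-δ) * f r) (𝓝[>] 0) atTop)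
    (hfδ_anti : AntitoneOn (fun r : ℝ => r ^ (-δ) * f r) (Ioi 0))
    (hfγ_mono : MonotoneOn (fun r : ℝ => r ^ (-γ) * f r) (Ioi 0)) :
    ∃ κ > 0, ∃ C > 0, ∃ (N : ℕ) (L : LevelSystem m f δ (δ - γ) κ C),
      (∀ n, L.ρ n = ρ (u (n + N))) ∧
      (∀ n, 2 ^ (γ - δ) * min (gFun f ψ ρ γ δ (u (n + N))) 1 ≤ L.weight n) ∧
      {x | ∃ᶠ n in atTop, x ∈ L.target n} ⊆ limsupSet R β ψ := by
  obtain ⟨⟨κ, r₁, hκ, hr₁, hubiq⟩, hint⟩ := hub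
  have hγδ := lt_of_monotoneOn_of_tendsto hf hfδ hfγ_mono
  have hρu_pos (n : ℕ) : 0 < ρ (u n) := hρ.pos _ (hu n)
  have hρu : Tendsto (fun n => ρ (u n)) atTop (𝓝 0) :=
    hρ.lim.comp (tendsto_atTop_mono (fun n => (hlu n).le) hl)
  have hρf : ∀ᶠ n in atTop, 1 ≤ ρ (u n) ^ (-δ) * f (ρ (u n)) :=
    (hfδ.comp (tendsto_nhdsWithin_iff.2
      ⟨hρu, Eventually.of_forall hρu_pos⟩)).eventually_ge_atTop 1
  obtain ⟨c₁, hc₁, c₂, hc₂, hbounds⟩ := hint.exists_hasIntersectionBounds hB hρu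
  obtain ⟨N, hN⟩ := eventually_atTop.1 (hbounds.and hρf)
  let t (n : ℕ) : ℝ := min (ψ (u n)) (ρ (u n)) / 2
  have hmin_pos (n : ℕ) : 0 < min (ψ (u n)) (ρ (u n)) := lt_min (hψ.pos _ (hu n)) (hρu_pos n)
  have htρ (n : ℕ) : t n ≤ ρ (u n) / 2 := div_le_div_of_nonneg_right (min_le_right _ _) zero_le_two
  have htψ (n : ℕ) : 2 * t n ≤ ψ (u n) :=
    (mul_div_cancel₀ _ two_ne_zero).trans_le (min_le_left _ _)
  obtain ⟨C, hC, L, hLρ, hLweight, hLtarget⟩ := Ubiquity.exists_levelSystem (κ := κ) (R := R)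
    (ρ := fun n => ρ (u (n + N))) (t := fun n => t (n + N))
    (I := fun n => {α | l (n + N) < β α ∧ β α ≤ u (n + N)}) hB hf hfδ_anti hfγ_mono hγδ
    (fun n => hρu_pos _) (hρu.comp (tendsto_add_atTop_nat N)) (fun n => half_pos (hmin_pos _))
    (fun n => htρ _) hc₁ hc₂ (fun n α hα => (hN _ (Nat.le_add_left N n)).1 α hα.2)
    ⟨r₁, hr₁, fun x r hr hr' => (tendsto_add_atTop_nat N).eventually
      (eventually_mul_measureReal_le_unionNhd hκ (hubiq x r hr hr'))⟩
  refine ⟨κ, hκ, C, hC, N, L, congrFun hLρ, fun n => ?_, ?_⟩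
  · rw [hLweight]
    exact mul_min_levelWeight_le (hρu_pos _) (hψ.pos _ (hu _)) hfδ_anti
      (hN _ (Nat.le_add_left N n)).2
  · exact Subset.trans (fun x hx => Frequently.mono hx fun n hn => hLtarget n hn)
      (frequently_subset_limsupSet hβ (hl.comp (tendsto_add_atTop_nat N)) hψ.anti
        fun n => htψ (n + N))

theorem hausdorffMeasureFun_limsupSet_eq_top [CompactSpace Ω] [NeZero m] (hm : PowerLaw m δ)
    (hub : LocallyUbiquitous m R β ρ l u γ) (hβ : ∀ α, 0 < β α) (hu : ∀ n, 0 < u n)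
    (hlu : ∀ n, l n < u n) (hl : Tendsto l atTop atTop) (hρ : IsUbiquityFunction ρ)
    (hψ : IsApproximating ψ) (hf : ∀ r, 0 < r → 0 < f r)
    (hfδ : Tendsto (fun r : ℝ => r ^ (-δ) * f r) (𝓝[>] 0) atTop)
    (hfδ_anti : AntitoneOn (fun r : ℝ => r ^ (-δ) * f r) (Ioi 0))
    (hfγ_mono : MonotoneOn (fun r : ℝ => r ^ (-γ) * f r) (Ioi 0))
    (hdiv : DivergesLacunarily (fun n => ρ (u n)) fun n => min (gFun f ψ ρ γ δ (u n)) 1) :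
    hausdorffMeasureFun f (limsupSet R β ψ) = ⊤ := by
  obtain ⟨a, b, r₀, hB⟩ := hm.exists_ahlforsBounds
  obtain ⟨κ, hκ, C, hC, N, L, hLρ, hLweight, hLsub⟩ :=
    hub.exists_levelSystem hB hβ hu hlu hl hρ hψ hf hfδ hfδ_anti hfγ_mono
  have hg (n : ℕ) : 0 ≤ min (gFun f ψ ρ γ δ (u n)) 1 :=
    le_min (levelWeight_pos hf (hψ.pos _ (hu n)) (hρ.pos _ (hu n))).le zero_le_one
  have hLdiv : DivergesLacunarily L.ρ L.weight := by
    rw [funext hLρ]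
    exact (hdiv.comp_add_right N).of_mul_le (c := 2 ^ (γ - δ)) (by positivity) (fun n => hg _)
      hLweight
  refine top_unique (le_trans (ge_of_eq ?_) (hausdorffMeasureFun_mono f hLsub))
  exact LevelSystem.hausdorffMeasureFun_eq_top hB
    (sub_pos.2 (lt_of_monotoneOn_of_tendsto hf hfδ hfγ_mono)) hκ hC hf hfδ hfδ_anti hLdiv

end LimsupSet

theorem divergesLacunarily_min_of_limsupG_pos {ρ' : ℕ → ℝ} {f ψ ρ : ℝ → ℝ} {γ δ : ℝ} {u : ℕ → ℝ}
    (hρ : ∀ n, 0 < ρ' n) (hρ0 : Tendsto ρ' atTop (𝓝 0)) (hG : 0 < limsupG f ψ ρ γ δ u) :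
    DivergesLacunarily ρ' fun n => min (gFun f ψ ρ γ δ (u n)) 1 := by
  obtain ⟨ε, hε, hεG⟩ := exists_between hG
  have hε' : 0 < ε.toReal := ENNReal.toReal_pos hε.ne' hεG.ne_top
  refine .of_frequently (ε := min ε.toReal 1) hρ hρ0 (by positivity) ?_
  rw [limsupG] at hεG
  refine (frequently_lt_of_lt_limsup (h := hεG)).mono fun n hn => min_le_min_right 1 ?_
  exact ((ENNReal.lt_ofReal_iff_toReal_lt hεG.ne_top).1 hn).le

end Ubiquity

open Ubiquity in
theorem theorem2_general {Ω J : Type*} [MetricSpace Ω] [CompactSpace Ω]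
    [MeasurableSpace Ω] [OpensMeasurableSpace Ω] {m : Measure Ω} [IsFiniteMeasure m] [NeZero m]
    {δ : ℝ} (hm : PowerLaw m δ) {R : J → Set Ω} {β : J → ℝ} (hβ : ∀ α, 0 < β α)
    {l u : ℕ → ℝ} (hu : ∀ n, 0 < u n) (hlu : ∀ n, l n < u n) (hl : Tendsto l atTop atTop)
    {ρ : ℝ → ℝ} (hρ : IsUbiquityFunction ρ) {γ : ℝ} (hub : LocallyUbiquitous m R β ρ l u γ)
    {ψ : ℝ → ℝ} (hψ : IsApproximating ψ) {f : ℝ → ℝ} (hf : ∀ r, 0 < r → 0 < f r)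
    (hfδ : Tendsto (fun r : ℝ => r ^ (-δ) * f r) (𝓝[>] 0) atTop)
    (hfδ_anti : AntitoneOn (fun r : ℝ => r ^ (-δ) * f r) (Ioi 0))
    (hfγ_mono : MonotoneOn (fun r : ℝ => r ^ (-γ) * f r) (Ioi 0))
    (h : IsRegularAlong u ρ ∧ ∑' n, ENNReal.ofReal (gFun f ψ ρ γ δ (u n)) = ⊤ ∨
      0 < limsupG f ψ ρ γ δ u) :
    hausdorffMeasureFun f (limsupSet R β ψ) = ⊤ := by
  have hρu_pos (n : ℕ) : 0 < ρ (u n) := hρ.pos _ (hu n)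
  have hρu : Tendsto (fun n => ρ (u n)) atTop (𝓝 0) :=
    hρ.lim.comp (tendsto_atTop_mono (fun n => (hlu n).le) hl)
  refine hausdorffMeasureFun_limsupSet_eq_top hm hub hβ hu hlu hl hρ hψ hf hfδ hfδ_anti hfγ_mono ?_
  rcases h with ⟨⟨c, hc, hc1, hreg⟩, hsum⟩ | hG
  · have hg (n : ℕ) : 0 ≤ min (gFun f ψ ρ γ δ (u n)) 1 :=
      le_min (levelWeight_pos hf (hψ.pos _ (hu n)) (hρu_pos n)).le zero_le_one
    exact .of_regular hρu_pos hg hc hc1 hreg fun hs =>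
      (summable_of_summable_min one_pos hs).tsum_ofReal_ne_top hsum
  · exact divergesLacunarily_min_of_limsupG_pos hρu_pos hρu hG

theorem theorem2 {Ω J : Type*} [MetricSpace Ω] [CompactSpace Ω]
    [MeasurableSpace Ω] [OpensMeasurableSpace Ω]
    (m : Measure Ω) [IsProbabilityMeasure m] (δ : ℝ) (hm : Ubiquity.PowerLaw m δ)
    [Countable J] [Infinite J] (R : J → Set Ω) (β : J → ℝ) (hβ : Ubiquity.IsWeight β)
    (l u : ℕ → ℝ) (hlu : Ubiquity.IsLowerUpper l u)
    (ρ : ℝ → ℝ) (hρ : Ubiquity.IsUbiquityFunction ρ)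
    (γ : ℝ) (hub : Ubiquity.LocallyUbiquitous m R β ρ l u γ)
    (ψ : ℝ → ℝ) (hψ : Ubiquity.IsApproximating ψ)
    (f : ℝ → ℝ) (hf : Ubiquity.IsDimensionFunction f)
    (hfδ : Tendsto (fun r : ℝ => r ^ (-δ) * f r) (𝓝[>] 0) atTop)
    (hfδ_anti : AntitoneOn (fun r : ℝ => r ^ (-δ) * f r) (Ioi 0))
    (hfγ_mono : MonotoneOn (fun r : ℝ => r ^ (-γ) * f r) (Ioi 0)) :
    (Ubiquity.limsupG f ψ ρ γ δ u = 0 → Ubiquity.IsRegularAlong u ρ →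
      ∑' n, ENNReal.ofReal (Ubiquity.gFun f ψ ρ γ δ (u n)) = ⊤ →
      Ubiquity.hausdorffMeasureFun f (Ubiquity.limsupSet R β ψ) = ⊤) ∧
    (0 < Ubiquity.limsupG f ψ ρ γ δ u →
      Ubiquity.hausdorffMeasureFun f (Ubiquity.limsupSet R β ψ) = ⊤) := by
  have general := theorem2_general hm hβ.pos (fun n => (hlu.l_pos n).trans (hlu.lt n)) hlu.lt
    hlu.l_lim hρ hub hψ hf.pos hfδ hfδ_anti hfγ_mono
  exact ⟨fun _ hreg hsum => general (.inl ⟨hreg, hsum⟩), fun hG => general (.inr hG)⟩
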